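/- **Setting.** Let $\mathbb X=(X_1,\dots,X_n)\in\mathbf R^{d\times n}$ be a known design, let $\Omega$ be a nonempty set of pairs $(i,j)$ with $1\le i<j\le n$, and put $N=|\Omega|$. For a symmetric $\Theta\in\mathbf R^{d\times d}$ let $\mathbf P_\Theta$ be the law of $Y=(Y_{(i,j)})_{(i,j)\in\Omega}\in\{0,1\}^\Omega$ with independent entries $Y_{(i,j)}\sim\mathrm{Bernoulli}(\sigma(X_i^\top\Theta X_j))$, $\sigma(t)=1/(1+e^{-t})$, and let $\ell_Y(\Theta)=\log \mathbf P_\Theta(Y)$ be the log-likelihood. Write $\|\Theta\|_{1,1}=\sum_{i,j}|\Theta_{ij}|$, let $\|\Theta\|_{0,0}$ be the number of nonzero rows of $\Theta$, $\|B\|_F^2=\sum_{i,j}B_{ij}^2$, $\|B\|_{F,\Omega}^2=\sum_{(i,j)\in\Omega}B_{ij}^2$, $$\mathcal P_{k,r}(M)=\{\Theta\in\mathbf R^{d\times d}\text{ symmetric}:\ \|\Theta\|_{1,1}<M,\ \|\Theta\|_{0,0}\le k,\ \operatorname{rank}\Theta\le r\},\qquad \mathcal P(M)=\mathcal P_{d,d}(M),$$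 and $\mathcal L(M)=\sigma'(M)=\sigma(M)(1-\sigma(M))$. For $c>0$ let $p(\Theta)=cKR+cK\log(de/K)$ with $R=\operatorname{rank}\Theta$, $K=\|\Theta\|_{0,0}$ (and $p(0)=0$). A penalised MLE is a map $Y\mapsto\hat\Theta=\hat\Theta(Y)$ into the symmetric matrices with $\|\hat\Theta\|_{1,1}\le M$ and $$-\ell_Y(\hat\Theta)+p(\hat\Theta)\le\inf_{\Theta\in\mathcal P(M)}\{-\ell_Y(\Theta)+p(\Theta)\}$$ for every value of $Y$ (any minimiser over $\mathcal P(M)$, or over its closure $\{\|\Theta\|_{1,1}\le M\}$, is allowed). Put $\Sigma_\star=\mathbb X^\top\Theta_\star\mathbb X$, $\hat\Sigma=\mathbb X^\top\hat\Theta\mathbb X$; $\mathrm E$ is the expectation under $Y\sim\mathbf P_{\Theta_\star}$. **Theorem.** There are universal constants $c_1>1$ and $C_2>0$ such that the following holds. (Upper bound.) For every $c>0$ there is a constant $C_1>3c$, depending only on $c$, such that for all $M>0$ with $c\ge c_1/\mathcal L(M)$, all $n,d,\mathbb X,\Omega$ as above with $\max_{(i,j)\in\Omega}|X_i^\top\Theta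 X_j|<M$ for all $\Theta\in\mathcal P(M)$, all $1\le r\le k\le d$, and every penalised MLE $\hat\Theta$ with penalty constant $c$, $$\sup_{\Theta_\star\in\mathcal P_{k,r}(M)}\frac1{2N}\mathrm E\big[\|\hat\Sigma-\Sigma_\star\|_{F,\Omega}^2\big]\le\frac{C_1}{\mathcal L(M)}\Big(\frac{kr}N+\frac kN\log\big(\tfrac{de}k\big)\Big);$$ with the same constant $C_1$ one also has $$\sup_{\Theta_\star\in\mathcal P_{k,r}(M)}\frac1N\mathrm E\big[\mathsf{KL}(\mathbf P_{\Theta_\star},\mathbf P_{\hat\Theta})\big]\le C_1\Big(\frac{kr}N+\frac kN\log\big(\tfrac{de}k\big)\Big).$$ (Minimax lower bound.) For all $M>0$, all $n,d,\mathbb X,\Omega$ as above, all $1\le r\le k\le d$ and all $\delta\in(0,1)$ such that the block isometry property $$N(1-\delta)\|B\|_F^2\le\|\mathbb X^\top B\,\mathbb X\|_{F,\Omega}^2\le N(1+\delta)\|B\|_F^2$$ holds for all symmetric $B$ with $\|B\|_{0,0}\le 2k$, and such that $N$ is large enough that $k^2\big(\frac{kr}N+\frac kN\log(\frac{de}k)\big)\le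 M^2$, $$\inf_{\hat S}\ \sup_{\Theta_\star\in\mathcal P_{k,r}(M)}\frac1{2N}\mathrm E\big[\|\hat S-\Sigma_\star\|_{F,\Omega}^2\big]\ge C_2\,\frac{1-\delta}{1+\delta}\Big(\frac{kr}N+\frac kN\log\big(\tfrac{de}k\big)\Big),$$ where the infimum is over all estimators $\hat S=\hat S(Y)\in\mathbf R^{n\times n}$. -/

import Mathlib

open MeasureTheory ProbabilityTheory
open scoped ENNReal

namespace MatrixLogistic

noncomputable section

/-- The coefficient-wise `ℓ¹` norm `‖Θ‖_{1,1}`. -/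
def norm11 {d : ℕ} (Θ : Matrix (Fin d) (Fin d) ℝ) : ℝ := ∑ i, ∑ j, |Θ i j|

/-- The block sparsity `‖Θ‖_{0,0}`: the number of nonzero rows of `Θ`. -/
def norm00 {d : ℕ} (Θ : Matrix (Fin d) (Fin d) ℝ) : ℕ := {i | Θ i ≠ 0}.ncard

/-- The squared Frobenius norm `‖B‖_F²`. -/
def frobSq {d : ℕ} (B : Matrix (Fin d) (Fin d) ℝ) : ℝ := ∑ i, ∑ j, B i j ^ 2

/-- The squared Frobenius semi-norm `‖B‖²_{F,Ω}` over the entries indexed by `Ω`. -/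
def frobSqOn {n : ℕ} (Ω : Finset (Fin n × Fin n)) (B : Matrix (Fin n) (Fin n) ℝ) : ℝ :=
  ∑ e ∈ Ω, B e.1 e.2 ^ 2

/-- The parameter space `𝒫_{k,r}(M)`: symmetric matrices with `‖Θ‖_{1,1} < M`, at most `k`
nonzero rows and rank at most `r`. -/
def paramSpace (d k r : ℕ) (M : ℝ) : Set (Matrix (Fin d) (Fin d) ℝ) :=
  {Θ | Θ.IsSymm ∧ norm11 Θ < M ∧ norm00 Θ ≤ k ∧ Θ.rank ≤ r}

/-- The affinity matrix `Σ = 𝕏ᵀ Θ 𝕏`, with entries `X_iᵀ Θ X_j`; the columns of `𝕏` are the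
explanatory variables `X_i`. -/
def affinity {d n : ℕ} (X : Matrix (Fin d) (Fin n) ℝ) (Θ : Matrix (Fin d) (Fin d) ℝ) :
    Matrix (Fin n) (Fin n) ℝ :=
  X.transpose * Θ * X

/-- The boundedness assumption: `max_{(i,j) ∈ Ω} |X_iᵀ Θ X_j| < M` for all
`Θ ∈ 𝒫(M) = 𝒫_{d,d}(M)`. -/
def BoundedDesign {d n : ℕ} (X : Matrix (Fin d) (Fin n) ℝ) (Ω : Finset (Fin n × Fin n))
    (M : ℝ) : Prop :=
  ∀ Θ ∈ paramSpace d d d M, ∀ e ∈ Ω, |affinity X Θ e.1 e.2| < M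

/-- The block isometry property of order `s` with constant `δ ∈ (0,1)`. -/
def BlockIsometry {d n : ℕ} (X : Matrix (Fin d) (Fin n) ℝ) (Ω : Finset (Fin n × Fin n))
    (s : ℕ) (δ : ℝ) : Prop :=
  0 < δ ∧ δ < 1 ∧ ∀ B : Matrix (Fin d) (Fin d) ℝ, B.IsSymm → norm00 B ≤ s →
    (Ω.card : ℝ) * (1 - δ) * frobSq B ≤ frobSqOn Ω (affinity X B) ∧
      frobSqOn Ω (affinity X B) ≤ (Ω.card : ℝ) * (1 + δ) * frobSq B

/-- The constant `𝓛(M) = σ'(M) = σ(M) (1 - σ(M))`. -/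
def curv (M : ℝ) : ℝ := Real.sigmoid M * (1 - Real.sigmoid M)

/-- The law `P_Θ` of the observed adjacency vector `(Y_e)_{e ∈ Ω}`: the entries are independent,
and `Y_(i,j)` is `true` (an edge) with probability `σ(X_iᵀ Θ X_j)`. -/
def law {d n : ℕ} (X : Matrix (Fin d) (Fin n) ℝ) (Ω : Finset (Fin n × Fin n))
    (Θ : Matrix (Fin d) (Fin d) ℝ) : Measure (Ω → Bool) :=
  Measure.pi fun e : Ω =>
    bernoulliMeasure true false (unitInterval.sigmoid (affinity X Θ e.1.1 e.1.2))

/-- The log-likelihood of `Θ` at the observation `y`: the sum over `(i,j) ∈ Ω` of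
`log σ(X_iᵀ Θ X_j)` if `(i,j)` is an edge and of `log (1 - σ(X_iᵀ Θ X_j))` otherwise. -/
def logLik {d n : ℕ} (X : Matrix (Fin d) (Fin n) ℝ) (Ω : Finset (Fin n × Fin n))
    (y : Ω → Bool) (Θ : Matrix (Fin d) (Fin d) ℝ) : ℝ :=
  ∑ e : Ω, if y e then Real.log (Real.sigmoid (affinity X Θ e.1.1 e.1.2))
    else Real.log (1 - Real.sigmoid (affinity X Θ e.1.1 e.1.2))

/-- The function `g(R,K) = c K R + c K log(d e / K)`, with `g(R,0) = 0`. -/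
def penFun (c : ℝ) (d R K : ℕ) : ℝ :=
  c * K * R + c * K * Real.log (d * Real.exp 1 / K)

/-- The penalty `p(Θ) = g(rank Θ, ‖Θ‖_{0,0})`. -/
def pen {d : ℕ} (c : ℝ) (Θ : Matrix (Fin d) (Fin d) ℝ) : ℝ :=
  penFun c d Θ.rank (norm00 Θ)

/-- `Θhat` is a penalised maximum likelihood estimator over `𝒫(M)`: for each observation `y`, the
value of `-ℓ_y + p` at `Θhat y` is at most its infimum over `𝒫(M)`. As `𝒫(M)` is not closed, the
infimum need not be attained there, so `Θhat y` may lie in the closure `‖Θ‖_{1,1} ≤ M`;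
a minimiser over `𝒫(M)`, and one over its closure, are both covered. -/
def IsPenalizedMLE {d n : ℕ} (c M : ℝ) (X : Matrix (Fin d) (Fin n) ℝ)
    (Ω : Finset (Fin n × Fin n)) (Θhat : (Ω → Bool) → Matrix (Fin d) (Fin d) ℝ) : Prop :=
  ∀ y, (Θhat y).IsSymm ∧ norm11 (Θhat y) ≤ M ∧
    ∀ Θ ∈ paramSpace d d d M,
      -logLik X Ω y (Θhat y) + pen c (Θhat y) ≤ -logLik X Ω y Θ + pen c Θ

/-- The prediction risk `(1/2N) E_Θ ‖Σhat - 𝕏ᵀ Θ 𝕏‖²_{F,Ω}`, where `N = |Ω|`. -/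
def predRisk {d n : ℕ} (X : Matrix (Fin d) (Fin n) ℝ) (Ω : Finset (Fin n × Fin n))
    (Shat : (Ω → Bool) → Matrix (Fin n) (Fin n) ℝ) (Θ : Matrix (Fin d) (Fin d) ℝ) : ℝ≥0∞ :=
  (∫⁻ y, ENNReal.ofReal (frobSqOn Ω (Shat y - affinity X Θ)) ∂(law X Ω Θ)) /
    (2 * (Ω.card : ℝ≥0∞))

/-- The Kullback–Leibler risk `(1/N) E_Θ KL(P_Θ, P_{Θhat})`, where `N = |Ω|`. -/
def klRisk {d n : ℕ} (X : Matrix (Fin d) (Fin n) ℝ) (Ω : Finset (Fin n × Fin n))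
    (Θhat : (Ω → Bool) → Matrix (Fin d) (Fin d) ℝ) (Θ : Matrix (Fin d) (Fin d) ℝ) : ℝ≥0∞ :=
  (∫⁻ y, InformationTheory.klDiv (law X Ω Θ) (law X Ω (Θhat y)) ∂(law X Ω Θ)) /
    (Ω.card : ℝ≥0∞)

/-- The rate `k r / N + (k / N) log(d e / k)`. -/
def rate (N d k r : ℕ) : ℝ :=
  (k : ℝ) * r / N + (k : ℝ) / N * Real.log (d * Real.exp 1 / k)

end

end MatrixLogistic

/-! Upper bound. The log-likelihood ratio equals the Kullback–Leibler divergence minus a form linear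
in the centred noise (`logLik_sub`), so minimality of the estimator gives `KL + pen(Θhat) ≤ noise +
pen(Θ)`, where the noise is paired with the difference `Δ` of the logits. On `[-M, M]` the
divergence dominates `curv M / 2 * ‖Δ‖²` (`curv_mul_sq_le_bernKL`). It remains to bound the noise
form by `√(level + W) * ‖Δ‖` simultaneously for all `Θhat`, with `level` of the order of the penalty
and `W` of bounded mean (`exists_excess`). Half of the divergence then absorbs `‖Δ‖²`, and the
penalty absorbs the level once `c` exceeds a multiple of `1 / curv M` (`sum_klSum_le`).

The uniform noise bound replaces covering numbers by tensor powers. For support `S` and rank `R`,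
normalised differences are values of a quadratic map in `1 + 2|S|R` variables, so their `q`-th
tensor powers lie in a space spanned by the monomials of degree `2q`. An approximate Auerbach basis
of the span (`exists_approx_auerbach`) bounds the `q`-th power of any linear form by its `q`-th
powers at finitely many of these vectors. With `q = |S|R + 1` the dimension is at most `16 ^ q`, so
taking `q`-th roots costs only a constant (`exists_lowRank_points`). Sub-Gaussian tails and a union
bound over vectors, ranks and supports finish.

Lower bound. An Assouad argument over a finite alphabet, with tests controlled by the chi-square
divergence (`exists_le_risk`), is transferred to matrices by the block isometry
(`le_iSup_predRisk`). Binary off-diagonal blocks give the term `k r / N` (`le_iSup_predRisk_block`);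
rank-one matrices with sparse vectors give the logarithmic term (`le_iSup_predRisk_rankOne`). The
larger term is at least half of their sum. -/

namespace MatrixLogistic

noncomputable section

/-! ### Scalar inequalities for Bernoulli laws in the logit. -/

/-- The mass function of the Bernoulli law with logit `t`. -/
def bernMass (t : ℝ) (b : Bool) : ℝ := if b then Real.sigmoid t else 1 - Real.sigmoid t

/-- The cumulant function `t ↦ log (1 + e ^ t)` of the logistic model. -/
def logPartition (t : ℝ) : ℝ := Real.log (1 + Real.exp t)

lemma bernMass_pos (t : ℝ) (b : Bool) : 0 < bernMass t b := by
  have h1 := Real.sigmoid_pos t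
  have h2 := Real.sigmoid_lt_one t
  unfold bernMass
  split_ifs <;> linarith

lemma sigmoid_eq_div (t : ℝ) : Real.sigmoid t = Real.exp t / (1 + Real.exp t) := by
  have := Real.exp_pos t
  rw [Real.sigmoid_def, Real.exp_neg]
  field_simp
  ring

lemma log_bernMass (t : ℝ) (b : Bool) :
    Real.log (bernMass t b) = (if b then t else 0) - logPartition t := by
  have := Real.exp_pos t
  cases b
  · have : 1 - Real.sigmoid t = 1 / (1 + Real.exp t) := by
      rw [sigmoid_eq_div]; field_simp; ring
    simp [bernMass, logPartition, this]
  · simp only [bernMass, if_true, logPartition, sigmoid_eq_div]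
    rw [Real.log_div (by positivity) (by positivity), Real.log_exp]

lemma hasDerivAt_logPartition (t : ℝ) : HasDerivAt logPartition (Real.sigmoid t) t := by
  have h : HasDerivAt (fun t => 1 + Real.exp t) (Real.exp t) t := by
    simpa using (Real.hasDerivAt_exp t).const_add 1
  rw [sigmoid_eq_div]
  exact h.log (by positivity)

/-- The Kullback–Leibler divergence between Bernoulli laws with logits `s` and `t`. -/
def bernKL (s t : ℝ) : ℝ := Real.sigmoid s * (s - t) - logPartition s + logPartition t

lemma curv_pos (M : ℝ) : 0 < curv M :=
  mul_pos (Real.sigmoid_pos M) (by linarith [Real.sigmoid_lt_one M])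

/-- `σ(t)` lies between `1 - σ(M)` and `σ(M)`, and `p (1 - p)` is concave and symmetric about `1/2`.
-/
lemma curv_le_of_abs_le {M t : ℝ} (h : |t| ≤ M) : curv M ≤ curv t := by
  obtain ⟨h1, h2⟩ := abs_le.mp h
  have h3 := Real.sigmoid_le h1
  have h4 := Real.sigmoid_le h2
  rw [Real.sigmoid_neg] at h3
  unfold curv
  nlinarith

lemma curv_mul_sub_le {M a b : ℝ} (ha : -M ≤ a) (hab : a ≤ b) (hb : b ≤ M) :
    curv M * (b - a) ≤ Real.sigmoid b - Real.sigmoid a := by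
  refine (convex_Icc a b).mul_sub_le_image_sub_of_le_deriv
    continuous_sigmoid.continuousOn differentiable_sigmoid.differentiableOn
    (fun x hx => ?_) a (by simp [hab]) b (by simp [hab]) hab
  rw [interior_Icc] at hx
  rw [Real.deriv_sigmoid]
  exact curv_le_of_abs_le (abs_le.mpr ⟨by linarith [hx.1], by linarith [hx.2]⟩)

/-- Strong convexity: in `t`, the divergence vanishes to first order at `t = s`, and its derivative
`σ(t) - σ(s)` grows at rate at least `curv M` on `[-M, M]`. -/
lemma curv_mul_sq_le_bernKL {M s t : ℝ} (hs : |s| ≤ M) (ht : |t| ≤ M) :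
    curv M / 2 * (t - s) ^ 2 ≤ bernKL s t := by
  set φ : ℝ → ℝ := fun x => bernKL s x - curv M / 2 * (x - s) ^ 2
  have hφ : ∀ x, HasDerivAt φ (Real.sigmoid x - Real.sigmoid s - curv M * (x - s)) x := by
    intro x
    have h1 := ((((hasDerivAt_id x).const_sub s).const_mul (Real.sigmoid s)).sub_const
      (logPartition s)).add (hasDerivAt_logPartition x)
    have h2 := (((hasDerivAt_id x).sub_const s).pow 2).const_mul (curv M / 2)
    refine (h1.sub h2).congr_deriv ?_
    simp
    ring
  have hd : Differentiable ℝ φ := fun x => (hφ x).differentiableAt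
  have h0 : φ s = 0 := by simp [φ, bernKL]
  obtain ⟨hs1, hs2⟩ := abs_le.mp hs
  obtain ⟨ht1, ht2⟩ := abs_le.mp ht
  suffices 0 ≤ φ t by simp only [φ] at this; linarith
  rcases le_total s t with hst | hst
  · have := (convex_Icc s t).mul_sub_le_image_sub_of_le_deriv (C := 0)
      hd.continuous.continuousOn hd.differentiableOn (fun x hx => by
        rw [interior_Icc] at hx
        rw [(hφ x).deriv]
        linarith [curv_mul_sub_le hs1 hx.1.le (hx.2.le.trans ht2)])
      s (by simp [hst]) t (by simp [hst]) hst
    linarith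
  · have := (convex_Icc t s).image_sub_le_mul_sub_of_deriv_le (C := 0)
      hd.continuous.continuousOn hd.differentiableOn (fun x hx => by
        rw [interior_Icc] at hx
        rw [(hφ x).deriv]
        linarith [curv_mul_sub_le (ht1.trans hx.1.le) hx.2.le hs2])
      t (by simp [hst]) s (by simp [hst]) hst
    linarith

/-- The linear term disappears on averaging a centred variable, which leaves a sub-Gaussian bound on
its exponential moment. -/
lemma exp_le_add_exp_sq (x : ℝ) : Real.exp x ≤ x + Real.exp (x ^ 2) := by
  rcases le_or_gt 1 |x| with h | h
  · rcases le_total 0 x with h0 | h0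
    · rw [abs_of_nonneg h0] at h
      have : Real.exp x ≤ Real.exp (x ^ 2) := Real.exp_le_exp.mpr (by nlinarith)
      linarith
    · rw [abs_of_nonpos h0] at h
      have h1 := Real.add_one_le_exp (x ^ 2)
      have h2 : Real.exp x ≤ 1 := by simpa using h0
      nlinarith
  · have h1 := Real.add_one_le_exp (x ^ 2)
    have h2 := Real.abs_exp_sub_one_sub_id_le h.le
    linarith [(abs_le.mp h2).2]

lemma bernMass_mgf_le (t a : ℝ) :
    bernMass t true * Real.exp (a * (1 - Real.sigmoid t)) +
      bernMass t false * Real.exp (a * (0 - Real.sigmoid t)) ≤ Real.exp (a ^ 2) := by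
  have h1 := Real.sigmoid_pos t
  have h2 := Real.sigmoid_lt_one t
  simp only [bernMass, if_true, Bool.false_eq_true, if_false]
  set p := Real.sigmoid t
  have key : ∀ u, |u| ≤ 1 → Real.exp (a * u) ≤ a * u + Real.exp (a ^ 2) := fun u hu =>
    (exp_le_add_exp_sq _).trans (by
      have : u ^ 2 ≤ 1 := by rw [← sq_abs]; nlinarith [abs_nonneg u]
      have h3 : Real.exp ((a * u) ^ 2) ≤ Real.exp (a ^ 2) :=
        Real.exp_le_exp.mpr (by nlinarith [sq_nonneg a])
      linarith)
  have k1 := key (1 - p) (abs_le.mpr ⟨by linarith, by linarith⟩)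
  have k2 := key (0 - p) (abs_le.mpr ⟨by linarith, by linarith⟩)
  nlinarith

/-- The left side is at most `cosh² ((s - t) / 2)`, the gap being an explicit square. No bound on
the logits enters, which keeps `curv M` out of the lower bound. -/
lemma bernMass_chiSq_le (s t : ℝ) :
    bernMass s true ^ 2 / bernMass t true + bernMass s false ^ 2 / bernMass t false ≤
      Real.exp ((s - t) ^ 2 / 4) := by
  have hx := Real.exp_pos s
  have hy := Real.exp_pos t
  have hc : Real.cosh ((s - t) / 2) ^ 2 ≤ Real.exp ((s - t) ^ 2 / 4) := by
    calc Real.cosh ((s - t) / 2) ^ 2 ≤ Real.exp (((s - t) / 2) ^ 2 / 2) ^ 2 := by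
          gcongr
          exact Real.cosh_le_exp_half_sq _
      _ = _ := by rw [← Real.exp_nat_mul]; congr 1; push_cast; ring
  refine le_trans ?_ hc
  have hc2 : Real.cosh ((s - t) / 2) ^ 2 =
      (2 + Real.exp s / Real.exp t + Real.exp t / Real.exp s) / 4 := by
    rw [Real.cosh_eq, ← Real.exp_sub, ← Real.exp_sub]
    have e1 : Real.exp (s - t) = Real.exp ((s - t) / 2) ^ 2 := by
      rw [← Real.exp_nat_mul]; congr 1; push_cast; ring
    have e2 : Real.exp (t - s) = Real.exp (-((s - t) / 2)) ^ 2 := by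
      rw [← Real.exp_nat_mul]; congr 1; push_cast; ring
    have e3 : Real.exp ((s - t) / 2) * Real.exp (-((s - t) / 2)) = 1 := by
      rw [← Real.exp_add]; simp
    rw [e1, e2]
    nlinarith
  rw [hc2]
  simp only [bernMass, if_true, Bool.false_eq_true, if_false, sigmoid_eq_div]
  generalize Real.exp s = x at *
  generalize Real.exp t = y at *
  have e1 : 1 - x / (1 + x) = 1 / (1 + x) := by field_simp; ring
  have e2 : 1 - y / (1 + y) = 1 / (1 + y) := by field_simp; ring
  rw [e1, e2]
  have : (2 + x / y + y / x) / 4 -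
      ((x / (1 + x)) ^ 2 / (y / (1 + y)) + (1 / (1 + x)) ^ 2 / (1 / (1 + y))) =
      (x - y) ^ 2 * (1 - x) ^ 2 / (4 * x * y * (1 + x) ^ 2) := by
    field_simp
    ring
  have h3 : 0 ≤ (x - y) ^ 2 * (1 - x) ^ 2 / (4 * x * y * (1 + x) ^ 2) := by positivity
  linarith

/-! ### Products of Bernoulli laws as explicit weights. -/

section Product

variable {E : Type*} [Fintype E]

/-- The mass function of the product of the Bernoulli laws with logits `s e`. -/
def bernWeight (s : E → ℝ) (y : E → Bool) : ℝ := ∏ e, bernMass (s e) (y e)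

/-- The centred observation `y e - σ(s e)`. -/
def noise (s : E → ℝ) (y : E → Bool) (e : E) : ℝ := (if y e then 1 else 0) - Real.sigmoid (s e)

lemma bernWeight_pos (s : E → ℝ) (y : E → Bool) : 0 < bernWeight s y :=
  Finset.prod_pos fun _ _ => bernMass_pos _ _

lemma log_bernWeight_sub (s t : E → ℝ) (y : E → Bool) :
    Real.log (bernWeight s y) - Real.log (bernWeight t y) =
      ∑ e, bernKL (s e) (t e) - ∑ e, noise s y e * (t e - s e) := by
  rw [bernWeight, bernWeight, Real.log_prod fun e _ => (bernMass_pos _ _).ne',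
    Real.log_prod fun e _ => (bernMass_pos _ _).ne', ← Finset.sum_sub_distrib,
    ← Finset.sum_sub_distrib]
  refine Finset.sum_congr rfl fun e _ => ?_
  rw [log_bernMass, log_bernMass, bernKL, noise]
  split_ifs <;> ring

variable [DecidableEq E]

lemma sum_prod_bool (f : E → Bool → ℝ) :
    ∑ y : E → Bool, ∏ e, f e (y e) = ∏ e, (f e true + f e false) := by
  rw [← Fintype.prod_sum]
  simp

lemma sum_bernWeight (s : E → ℝ) : ∑ y, bernWeight s y = 1 := by
  simp only [bernWeight]
  rw [sum_prod_bool fun e => bernMass (s e)]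
  simp [bernMass]

lemma sum_bernWeight_mul_exp_le (s a : E → ℝ) :
    ∑ y, bernWeight s y * Real.exp (∑ e, a e * noise s y e) ≤ Real.exp (∑ e, a e ^ 2) := by
  have h : ∀ y, bernWeight s y * Real.exp (∑ e, a e * noise s y e) =
      ∏ e, (fun b => bernMass (s e) b *
        Real.exp (a e * ((if b then 1 else 0) - Real.sigmoid (s e)))) (y e) := by
    intro y
    rw [bernWeight, Real.exp_sum, ← Finset.prod_mul_distrib]
    rfl
  simp_rw [h]
  rw [sum_prod_bool fun e b => bernMass (s e) b *
        Real.exp (a e * ((if b then 1 else 0) - Real.sigmoid (s e))), Real.exp_sum]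
  refine Finset.prod_le_prod (fun e _ => ?_) fun e _ => ?_
  · have := bernMass_pos (s e) true
    have := bernMass_pos (s e) false
    positivity
  · simpa using bernMass_mgf_le (s e) (a e)

lemma sum_bernWeight_sq_div_le (s t : E → ℝ) :
    ∑ y, bernWeight s y ^ 2 / bernWeight t y ≤ Real.exp (∑ e, (s e - t e) ^ 2 / 4) := by
  have h : ∀ y, bernWeight s y ^ 2 / bernWeight t y =
      ∏ e, (fun b => bernMass (s e) b ^ 2 / bernMass (t e) b) (y e) := by
    intro y
    rw [bernWeight, bernWeight, ← Finset.prod_pow, ← Finset.prod_div_distrib]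
  simp_rw [h]
  rw [sum_prod_bool fun e b => bernMass (s e) b ^ 2 / bernMass (t e) b, Real.exp_sum]
  refine Finset.prod_le_prod (fun e _ => ?_) fun e _ => bernMass_chiSq_le _ _
  have := bernMass_pos (t e) true
  have := bernMass_pos (t e) false
  positivity

lemma sum_bernWeight_mul_noise (s : E → ℝ) (e : E) : ∑ y, bernWeight s y * noise s y e = 0 := by
  have h : ∀ y, bernWeight s y * noise s y e =
      ∏ e', (fun b => bernMass (s e') b *
        (if e' = e then ((if b then 1 else 0) - Real.sigmoid (s e)) else 1)) (y e') := by
    intro y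
    rw [bernWeight, Finset.prod_mul_distrib]
    simp [noise]
  simp_rw [h]
  rw [sum_prod_bool fun e' b => bernMass (s e') b *
        (if e' = e then ((if b then 1 else 0) - Real.sigmoid (s e)) else 1)]
  refine Finset.prod_eq_zero (Finset.mem_univ e) ?_
  simp [bernMass]
  ring

lemma sum_bernWeight_mul_log_sub (s t : E → ℝ) :
    ∑ y, bernWeight s y * (Real.log (bernWeight s y) - Real.log (bernWeight t y)) =
      ∑ e, bernKL (s e) (t e) := by
  have : ∑ y, bernWeight s y * ∑ e, noise s y e * (t e - s e) = 0 := by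
    simp_rw [Finset.mul_sum]
    rw [Finset.sum_comm]
    refine Finset.sum_eq_zero fun e _ => ?_
    simp_rw [← mul_assoc, ← Finset.sum_mul, sum_bernWeight_mul_noise, zero_mul]
  simp_rw [log_bernWeight_sub, mul_sub (bernWeight s _), Finset.sum_sub_distrib]
  rw [this, sub_zero, ← Finset.sum_mul, sum_bernWeight, one_mul]

end Product

/-! ### The observed law: integrals and divergences as finite sums. -/

section Law

variable {d n : ℕ} (X : Matrix (Fin d) (Fin n) ℝ) (Ω : Finset (Fin n × Fin n))

/-- The vector of logits `X_iᵀ Θ X_j`, `(i, j) ∈ Ω`. -/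
def logits (Θ : Matrix (Fin d) (Fin d) ℝ) (e : Ω) : ℝ := affinity X Θ e.1.1 e.1.2

instance (Θ : Matrix (Fin d) (Fin d) ℝ) : IsProbabilityMeasure (law X Ω Θ) := by
  unfold law; infer_instance

lemma law_singleton (Θ : Matrix (Fin d) (Fin d) ℝ) (y : Ω → Bool) :
    law X Ω Θ {y} = ENNReal.ofReal (bernWeight (logits X Ω Θ) y) := by
  rw [law, Measure.pi_singleton, bernWeight,
    ENNReal.ofReal_prod_of_nonneg fun e _ => (bernMass_pos _ _).le]
  refine Finset.prod_congr rfl fun e _ => ?_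
  classical
  rw [bernoulliMeasure_apply _ (by simp)]
  cases h : y e <;> simp [bernMass, logits, ENNReal.ofReal]
  · ext
    simp [unitInterval.sigmoid, Real.sigmoid_le_one]
    rfl
  · ext
    simp [unitInterval.sigmoid, Real.sigmoid_nonneg]
    rfl

lemma lintegral_law (Θ : Matrix (Fin d) (Fin d) ℝ) (f : (Ω → Bool) → ℝ≥0∞) :
    ∫⁻ y, f y ∂(law X Ω Θ) = ∑ y, f y * ENNReal.ofReal (bernWeight (logits X Ω Θ) y) := by
  simp [lintegral_fintype, law_singleton]

lemma lintegral_law_ofReal (Θ : Matrix (Fin d) (Fin d) ℝ) (f : (Ω → Bool) → ℝ)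
    (hf : ∀ y, 0 ≤ f y) :
    ∫⁻ y, ENNReal.ofReal (f y) ∂(law X Ω Θ) =
      ENNReal.ofReal (∑ y, bernWeight (logits X Ω Θ) y * f y) := by
  rw [lintegral_law, ENNReal.ofReal_sum_of_nonneg fun y _ =>
    mul_nonneg (bernWeight_pos _ _).le (hf y)]
  refine Finset.sum_congr rfl fun y _ => ?_
  rw [ENNReal.ofReal_mul (bernWeight_pos _ _).le, mul_comm]

lemma logLik_eq (y : Ω → Bool) (Θ : Matrix (Fin d) (Fin d) ℝ) :
    logLik X Ω y Θ = Real.log (bernWeight (logits X Ω Θ) y) := by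
  rw [bernWeight, Real.log_prod fun e _ => (bernMass_pos _ _).ne', logLik]
  refine Finset.sum_congr rfl fun e _ => ?_
  cases h : y e <;> simp [bernMass, logits]

lemma law_eq_withDensity (Θ Θ' : Matrix (Fin d) (Fin d) ℝ) :
    law X Ω Θ = (law X Ω Θ').withDensity fun y =>
      ENNReal.ofReal (bernWeight (logits X Ω Θ) y / bernWeight (logits X Ω Θ') y) := by
  refine Measure.ext_of_singleton fun y => ?_
  rw [withDensity_apply _ (by simp), lintegral_singleton, law_singleton, law_singleton,
    ← ENNReal.ofReal_mul (div_pos (bernWeight_pos _ _) (bernWeight_pos _ _)).le,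
    div_mul_cancel₀ _ (bernWeight_pos _ _).ne']

/-- All atoms have positive mass, so the density is the ratio of the weights, and averaging the
log-ratio removes its centred noise part. -/
lemma klDiv_law (Θ Θ' : Matrix (Fin d) (Fin d) ℝ) :
    InformationTheory.klDiv (law X Ω Θ) (law X Ω Θ') =
      ENNReal.ofReal (∑ e, bernKL (logits X Ω Θ e) (logits X Ω Θ' e)) := by
  have hac : law X Ω Θ ≪ law X Ω Θ' := by
    rw [law_eq_withDensity X Ω Θ Θ']
    exact withDensity_absolutelyContinuous _ _
  have hd : (law X Ω Θ).rnDeriv (law X Ω Θ') =ᵐ[law X Ω Θ'] fun y =>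
      ENNReal.ofReal (bernWeight (logits X Ω Θ) y / bernWeight (logits X Ω Θ') y) := by
    conv_lhs => rw [law_eq_withDensity X Ω Θ Θ']
    exact Measure.rnDeriv_withDensity _ (measurable_of_finite _)
  rw [InformationTheory.klDiv_of_ac_of_integrable hac .of_finite]
  simp only [probReal_univ, add_sub_cancel_right]
  congr 1
  rw [← sum_bernWeight_mul_log_sub]
  have : ∫ y, llr (law X Ω Θ) (law X Ω Θ') y ∂(law X Ω Θ) =
      ∫ y, (Real.log (bernWeight (logits X Ω Θ) y) -
        Real.log (bernWeight (logits X Ω Θ') y)) ∂(law X Ω Θ) := by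
    refine integral_congr_ae ?_
    filter_upwards [hac.ae_le hd] with y hy
    rw [llr, hy, ENNReal.toReal_ofReal (div_pos (bernWeight_pos _ _) (bernWeight_pos _ _)).le,
      Real.log_div (bernWeight_pos _ _).ne' (bernWeight_pos _ _).ne']
  rw [this, integral_fintype .of_finite]
  refine Finset.sum_congr rfl fun y _ => ?_
  rw [measureReal_def, law_singleton, ENNReal.toReal_ofReal (bernWeight_pos _ _).le, smul_eq_mul]

end Law

/-! ### Approximate Auerbach bases. -/

open Module in
/-- A bounded set `B` in a finite-dimensional space contains at most `dim (span B)` points in which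
every point of `B` expands with coefficients of modulus at most `2` (an approximate Auerbach
basis). -/
lemma exists_approx_auerbach {V : Type*} [NormedAddCommGroup V] [NormedSpace ℝ V]
    [FiniteDimensional ℝ V] {B : Set V} (hB : Bornology.IsBounded B) :
    ∃ v : Fin (finrank ℝ (Submodule.span ℝ B)) → V, (∀ i, v i ∈ B) ∧
      ∀ w ∈ B, ∃ c : Fin (finrank ℝ (Submodule.span ℝ B)) → ℝ,
        (∀ i, |c i| ≤ 2) ∧ w = ∑ i, c i • v i := by
  classical
  set W := Submodule.span ℝ B with hW
  set N := finrank ℝ W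
  obtain ⟨S, hSB, hspan, hli⟩ := exists_linearIndependent ℝ B
  have hfinS : Finite S := hli.finite
  have : Fintype S := Fintype.ofFinite S
  let e0 : Basis S ℝ W := (Basis.span hli).map (LinearEquiv.ofEq _ _ (by simp [hspan, hW]))
  have he0 : ∀ s : S, ((e0 s : W) : V) = s := by
    intro s
    simp [e0, Basis.span_apply]
  have hcard : Fintype.card S = N := (finrank_eq_card_basis e0).symm
  let eqv : S ≃ Fin N := Fintype.equivFinOfCardEq hcard
  let b : Basis (Fin N) ℝ W := e0.reindex eqv
  have hb : ∀ i, ((b i : W) : V) ∈ B := fun i => by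
    simp only [b, Basis.reindex_apply, he0]
    exact hSB (Subtype.prop _)
  let T := {v : Fin N → W // ∀ i, (v i : V) ∈ B}
  let D : T → ℝ := fun v => |b.det v.1|
  have hbdd : BddAbove (Set.range D) := by
    obtain ⟨R, hR⟩ := hB.exists_norm_le
    have hcont : Continuous (b.equivFun : W →ₗ[ℝ] (Fin N → ℝ)) :=
      LinearMap.continuous_of_finiteDimensional _
    let L : W →L[ℝ] (Fin N → ℝ) := ⟨(b.equivFun : W →ₗ[ℝ] (Fin N → ℝ)), hcont⟩
    refine ⟨Nat.factorial N • (‖L‖ * R) ^ N, ?_⟩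
    rintro _ ⟨v, rfl⟩
    have := Matrix.det_le (A := b.toMatrix v.1) (abv := AbsoluteValue.abs) (x := ‖L‖ * R)
      (fun i j => by
        have h1 : ‖L (v.1 j) i‖ ≤ ‖L (v.1 j)‖ := norm_le_pi_norm _ _
        have h2 := L.le_opNorm (v.1 j)
        have h3 : ‖v.1 j‖ ≤ R := hR _ (v.2 j)
        have h4 : ‖L‖ * ‖v.1 j‖ ≤ ‖L‖ * R := by gcongr
        exact h1.trans (h2.trans h4))
    simpa [D, Basis.det_apply] using this
  let v0 : T := ⟨b, hb⟩
  have hv0 : D v0 = 1 := by simp [D, v0, Basis.det_self]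
  have hsup : 1 ≤ ⨆ v, D v := hv0 ▸ le_ciSup hbdd v0
  have : Nonempty T := ⟨v0⟩
  -- As `B` need not be closed, the largest determinant may not be attained; a tuple within a factor
  -- `2` of the supremum is what gives coefficients bounded by `2`.
  obtain ⟨v, hv⟩ := exists_lt_of_lt_ciSup (show (⨆ v, D v) / 2 < ⨆ v, D v by linarith)
  have hdpos : 0 < |b.det v.1| := by
    have : (⨆ v, D v) / 2 < |b.det v.1| := hv
    linarith
  have hdne : b.det v.1 ≠ 0 := abs_pos.mp hdpos
  refine ⟨fun i => v.1 i, v.2, fun w hw => ?_⟩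
  let w' : W := ⟨w, Submodule.subset_span hw⟩
  -- Cramer's rule: each coefficient is a quotient of determinants of two tuples from `B`.
  refine ⟨fun i => b.det (Function.update v.1 i w') / b.det v.1, fun i => ?_, ?_⟩
  · let u : T := ⟨Function.update v.1 i w', fun j => by
      by_cases h : j = i
      · subst h; simpa using hw
      · simpa [h] using v.2 j⟩
    have h1 : |b.det (Function.update v.1 i w')| ≤ ⨆ v, D v := le_ciSup hbdd u
    have h2 : (⨆ v, D v) / 2 < |b.det v.1| := hv
    rw [abs_div, div_le_iff₀ hdpos]
    linarith
  · have key : b.det v.1 • w' = ∑ i, b.det (Function.update v.1 i w') • v.1 i := by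
      apply b.equivFun.injective
      have h := Matrix.mulVec_cramer (b.toMatrix v.1) (b.equivFun w')
      rw [map_smul, map_sum, Basis.det_apply, ← h]
      ext j
      simp only [Matrix.mulVec, dotProduct, Finset.sum_apply, map_smul, Pi.smul_apply, smul_eq_mul]
      refine Finset.sum_congr rfl fun i _ => ?_
      rw [mul_comm, Matrix.cramer_apply, Basis.det_apply, Basis.toMatrix_update]
      rfl
    have h2 : w' = ∑ i, (b.det (Function.update v.1 i w') / b.det v.1) • v.1 i := by
      calc w' = (b.det v.1)⁻¹ • b.det v.1 • w' := by rw [smul_smul, inv_mul_cancel₀ hdne, one_smul]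
        _ = _ := by
          rw [key, Finset.smul_sum]
          refine Finset.sum_congr rfl fun i _ => ?_
          rw [smul_smul, div_eq_inv_mul]
    have h3 := congrArg (fun x : W => (x : V)) h2
    simpa [w'] using h3

/-! ### Tensor powers of values of a quadratic map. -/

section Tensor

variable {E ι : Type*} [Fintype ι]

/-- The value at `z` of the quadratic map with coefficients `M`. -/
def quadMap (M : E → ι → ι → ℝ) (z : ι → ℝ) (e : E) : ℝ := ∑ a, ∑ b, M e a b * (z a * z b)

/-- The unordered tuple underlying `q` ordered pairs. -/
def pairsSym {q : ℕ} (f : Fin q → ι × ι) : Sym ι (q + q) :=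
  ⟨Finset.univ.val.map (fun l => (f l).1) + Finset.univ.val.map (fun l => (f l).2), by simp⟩

/-- The linear map expressing tensor powers of `quadMap M z` through the monomials of `z`. -/
def monomialMap (M : E → ι → ι → ℝ) (q : ℕ) :
    (Sym ι (q + q) → ℝ) →ₗ[ℝ] ((Fin q → E) → ℝ) where
  toFun c j := ∑ f : Fin q → ι × ι, (∏ l, M (j l) (f l).1 (f l).2) * c (pairsSym f)
  map_add' c c' := by
    ext j
    simp [mul_add, Finset.sum_add_distrib]
  map_smul' r c := by
    ext j
    simp [Finset.mul_sum, mul_left_comm]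

/-- Expanding the product picks a pair of variables in each factor. The resulting monomial depends
only on the unordered tuple, so the dimension is a binomial coefficient rather than a power of the
number of variables. -/
lemma monomialMap_apply_prod (M : E → ι → ι → ℝ) (q : ℕ) (z : ι → ℝ) :
    monomialMap M q (fun s => ((s : Multiset ι).map z).prod) =
      fun j => ∏ l, quadMap M z (j l) := by
  classical
  ext j
  simp only [monomialMap, LinearMap.coe_mk, AddHom.coe_mk, quadMap]
  have : ∀ e, ∑ a, ∑ b, M e a b * (z a * z b) =
      ∑ p : ι × ι, M e p.1 p.2 * (z p.1 * z p.2) := fun e => by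
    rw [Fintype.sum_prod_type]
  simp_rw [this]
  rw [Fintype.prod_sum]
  refine Finset.sum_congr rfl fun f _ => ?_
  rw [Finset.prod_mul_distrib, Finset.prod_mul_distrib]
  congr 1
  simp [pairsSym, Finset.prod]
  rfl

variable [Fintype E]

/-- Finitely many points control every linear form on a set of vectors proportional to values of a
quadratic map. The number of points is at most the number of monomials of degree `2q`. -/
lemma exists_points_pow_le (M : E → ι → ι → ℝ) (q : ℕ) {𝒱 : Set (E → ℝ)}
    (h𝒱 : ∀ v ∈ 𝒱, ∃ r z, v = fun e => r * quadMap M z e) (hbd : ∀ v ∈ 𝒱, ∀ e, |v e| ≤ 1) :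
    ∃ N ≤ (Fintype.card ι + (q + q) - 1).choose (q + q), ∃ v : Fin N → E → ℝ,
      (∀ i, v i ∈ 𝒱) ∧ ∀ w ∈ 𝒱, ∀ x : E → ℝ,
        |∑ e, x e * w e| ^ q ≤ 2 * ∑ i, |∑ e, x e * v i e| ^ q := by
  classical
  let tp : (E → ℝ) → ((Fin q → E) → ℝ) := fun v j => ∏ l, v (j l)
  have hB : Bornology.IsBounded (tp '' 𝒱) := by
    refine isBounded_iff_forall_norm_le.mpr ⟨1, ?_⟩
    rintro _ ⟨v, hv, rfl⟩
    refine (pi_norm_le_iff_of_nonneg zero_le_one).mpr fun j => ?_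
    simp only [tp, Real.norm_eq_abs, Finset.abs_prod]
    exact Finset.prod_le_one (fun _ _ => abs_nonneg _) fun l _ => hbd v hv _
  have hle : Submodule.span ℝ (tp '' 𝒱) ≤ LinearMap.range (monomialMap M q) := by
    rw [Submodule.span_le]
    rintro _ ⟨v, hv, rfl⟩
    obtain ⟨r, z, rfl⟩ := h𝒱 v hv
    refine ⟨r ^ q • fun s : Sym ι (q + q) => ((s : Multiset ι).map z).prod, ?_⟩
    rw [map_smul, monomialMap_apply_prod]
    ext j
    simp [tp, Finset.prod_mul_distrib]
  have hdim : Module.finrank ℝ (Submodule.span ℝ (tp '' 𝒱)) ≤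
      (Fintype.card ι + (q + q) - 1).choose (q + q) := by
    calc _ ≤ Module.finrank ℝ (LinearMap.range (monomialMap M q)) := Submodule.finrank_mono hle
      _ ≤ Module.finrank ℝ (Sym ι (q + q) → ℝ) := LinearMap.finrank_range_le _
      _ = _ := by rw [Module.finrank_fintype_fun_eq_card, Sym.card_sym_eq_choose]
  obtain ⟨v, hv, hw⟩ := exists_approx_auerbach hB
  choose u hu huv using hv
  refine ⟨_, hdim, u, hu, fun w hwV x => ?_⟩
  obtain ⟨c, hc, hwc⟩ := hw (tp w) ⟨w, hwV, rfl⟩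
  -- The linear form `x^{⊗q}`: on tensor powers it returns the `q`-th power of the form given by
  -- `x`, so an expansion of the tensor power bounds that power.
  let φ : ((Fin q → E) → ℝ) → ℝ := fun t => ∑ j, (∏ l, x (j l)) * t j
  have hφ : ∀ v, φ (tp v) = (∑ e, x e * v e) ^ q := by
    intro v
    rw [Fintype.sum_pow]
    simp [φ, tp, Finset.prod_mul_distrib]
  rw [← abs_pow, ← hφ, hwc]
  have : φ (∑ i, c i • v i) = ∑ i, c i * φ (v i) := by
    simp only [φ, Finset.sum_apply, Pi.smul_apply, smul_eq_mul, Finset.mul_sum]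
    rw [Finset.sum_comm]
    exact Finset.sum_congr rfl fun i _ => Finset.sum_congr rfl fun j _ => by ring
  rw [this, Finset.mul_sum]
  refine (Finset.abs_sum_le_sum_abs _ _).trans (Finset.sum_le_sum fun i _ => ?_)
  rw [abs_mul, ← huv, hφ, abs_pow]
  exact mul_le_mul_of_nonneg_right (hc i) (by positivity)

end Tensor

/-! ### Finitely many directions controlling all matrices of given support and rank. -/

lemma exists_rank_factorization {d : ℕ} (Θ : Matrix (Fin d) (Fin d) ℝ) :
    ∃ U V : Fin d → Fin Θ.rank → ℝ, ∀ a b, Θ a b = ∑ r, U a r * V b r := by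
  let W := LinearMap.range Θ.mulVecLin
  let β : Module.Basis (Fin Θ.rank) ℝ W := Module.finBasis ℝ W
  have hmem : ∀ b, Θ.col b ∈ W := fun b => ⟨Pi.single b 1, by simp⟩
  refine ⟨fun a r => (β r : Fin d → ℝ) a, fun b r => β.repr ⟨Θ.col b, hmem b⟩ r, fun a b => ?_⟩
  have h := congrArg (fun x : W => (x : Fin d → ℝ) a) (β.sum_repr ⟨Θ.col b, hmem b⟩)
  simp only [Submodule.coe_sum, Finset.sum_apply, Submodule.coe_smul, Pi.smul_apply,
    smul_eq_mul, Matrix.col_apply] at h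
  rw [← h]
  exact Finset.sum_congr rfl fun r _ => mul_comm _ _

section LowRank

variable {d n : ℕ} (X : Matrix (Fin d) (Fin n) ℝ) (Ω : Finset (Fin n × Fin n))

/-- The coefficients of the quadratic map `(1, U, V) ↦ 𝕏ᵀ U Vᵀ 𝕏 - s` on `Ω`. -/
def lowRankCoeff (s : Ω → ℝ) (S : Finset (Fin d)) (R : ℕ) (e : Ω) :
    Option ((S × Fin R) ⊕ (S × Fin R)) → Option ((S × Fin R) ⊕ (S × Fin R)) → ℝ
  | none, none => - s e
  | some (.inl p), some (.inr p') => if p.2 = p'.2 then X p.1 e.1.1 * X p'.1 e.1.2 else 0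
  | _, _ => 0

lemma logits_eq_sum (Θ : Matrix (Fin d) (Fin d) ℝ) (e : Ω) :
    logits X Ω Θ e = ∑ a, ∑ b, X a e.1.1 * Θ a b * X b e.1.2 := by
  simp only [logits, affinity, Matrix.mul_apply, Matrix.transpose_apply, Finset.sum_mul]
  rw [Finset.sum_comm]

/-- A factorisation `Θ = U Vᵀ` restricted to `S` uses `2|S|R` variables; one further variable, set
to `1`, makes the shift by `s` homogeneous of degree two. -/
lemma logits_sub_eq_quadMap (s : Ω → ℝ) (S : Finset (Fin d)) {R : ℕ}
    {Θ : Matrix (Fin d) (Fin d) ℝ} (hS : ∀ a b, Θ a b ≠ 0 → a ∈ S ∧ b ∈ S) (hR : Θ.rank = R) :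
    ∃ z, ∀ e, logits X Ω Θ e - s e = quadMap (lowRankCoeff X Ω s S R) z e := by
  subst hR
  obtain ⟨U, V, hUV⟩ := exists_rank_factorization Θ
  refine ⟨fun o => o.elim 1 (Sum.elim (fun p => U p.1 p.2) fun p => V p.1 p.2), fun e => ?_⟩
  have h1 : logits X Ω Θ e = ∑ a : S, ∑ b : S, X a e.1.1 * Θ a b * X b e.1.2 := by
    rw [logits_eq_sum]
    have hb : ∀ a, ∑ b, X a e.1.1 * Θ a b * X b e.1.2 =
        ∑ b : S, X a e.1.1 * Θ a b * X b e.1.2 := fun a => by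
      rw [Finset.sum_coe_sort S fun b => X a e.1.1 * Θ a b * X b e.1.2]
      refine (Finset.sum_subset (Finset.subset_univ S) fun b _ hb => ?_).symm
      have : Θ a b = 0 := by
        by_contra h
        exact hb (hS a b h).2
      simp [this]
    simp_rw [hb]
    rw [Finset.sum_coe_sort S fun a => ∑ b : S, X a e.1.1 * Θ a b * X b e.1.2]
    refine (Finset.sum_subset (Finset.subset_univ S) fun a _ ha => ?_).symm
    refine Finset.sum_eq_zero fun b _ => ?_
    have : Θ a b = 0 := by
      by_contra h
      exact ha (hS a b h).1
    simp [this]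
  have h2 : ∀ a b : S, X a e.1.1 * Θ a b * X b e.1.2 =
      ∑ r, X a e.1.1 * X b e.1.2 * (U a r * V b r) := fun a b => by
    rw [hUV, ← Finset.mul_sum]; ring
  simp only [quadMap, Fintype.sum_option, Fintype.sum_sum_type, lowRankCoeff, Option.elim,
    Sum.elim_inl, Sum.elim_inr, zero_mul, Finset.sum_const_zero, add_zero, zero_add,
    Fintype.sum_prod_type, ite_mul, Finset.sum_ite_eq, Finset.mem_univ, if_true, mul_one]
  rw [h1]
  simp_rw [h2]
  rw [sub_eq_neg_add]
  congr 1
  refine Finset.sum_congr rfl fun a _ => ?_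
  rw [Finset.sum_comm]

/-- The binomial coefficient counts monomials of degree `2(m + 1)` in `1 + 2m` variables. Taking the
tensor exponent comparable to the number of variables makes this count exponential in the exponent,
so its root is bounded. -/
lemma two_mul_choose_le (m : ℕ) :
    2 * (1 + 2 * m + (m + 1 + (m + 1)) - 1).choose (m + 1 + (m + 1)) ≤ 32 ^ (m + 1) ∧
      (1 + 2 * m + (m + 1 + (m + 1)) - 1).choose (m + 1 + (m + 1)) ≤ 16 ^ (m + 1) := by
  have h := Nat.choose_le_two_pow (1 + 2 * m + (m + 1 + (m + 1)) - 1) (m + 1 + (m + 1))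
  have e : 1 + 2 * m + (m + 1 + (m + 1)) - 1 = 4 * m + 2 := by omega
  rw [e] at h ⊢
  have e16 : 16 ^ (m + 1) = 2 ^ (4 * m + 2) * 4 := by
    rw [show (16 : ℕ) = 2 ^ 4 by norm_num, ← pow_mul, show 4 * (m + 1) = 4 * m + 2 + 2 by ring,
      pow_add]
    norm_num
  have h32 : 16 ^ (m + 1) ≤ 32 ^ (m + 1) := Nat.pow_le_pow_left (by norm_num) _
  omega

/-- For every support `S` and rank `R` there are at most `16 ^ (|S| R + 1)` unit vectors which
control, up to a factor `32`, every linear form on the normalised differences `𝕏ᵀ Θ 𝕏 - s`. -/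
lemma exists_lowRank_points (s : Ω → ℝ) (S : Finset (Fin d)) (R : ℕ) :
    ∃ N ≤ 16 ^ (S.card * R + 1), ∃ v : Fin N → Ω → ℝ, (∀ i, ∑ e, v i e ^ 2 = 1) ∧
      ∀ Θ : Matrix (Fin d) (Fin d) ℝ, (∀ a b, Θ a b ≠ 0 → a ∈ S ∧ b ∈ S) → Θ.rank = R →
        ∀ (x : Ω → ℝ) (t : ℝ), 0 ≤ t → (∀ i, |∑ e, x e * v i e| ≤ t) →
          |∑ e, x e * (logits X Ω Θ e - s e)| ≤
            32 * t * Real.sqrt (∑ e, (logits X Ω Θ e - s e) ^ 2) := by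
  set m := S.card * R
  let 𝒱 : Set (Ω → ℝ) := {v | ∑ e, v e ^ 2 = 1 ∧
    ∃ r z, v = fun e => r * quadMap (lowRankCoeff X Ω s S R) z e}
  obtain ⟨N, hN, v, hv, hw⟩ := exists_points_pow_le (lowRankCoeff X Ω s S R) (m + 1) (𝒱 := 𝒱)
    (fun v hv => hv.2) (fun v hv e => by
      rw [← sq_le_one_iff_abs_le_one, ← hv.1]
      exact Finset.single_le_sum (f := fun e => v e ^ 2) (fun _ _ => sq_nonneg _)
        (Finset.mem_univ e))
  have hcard : Fintype.card (Option ((S × Fin R) ⊕ (S × Fin R))) = 1 + 2 * m := by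
    simp [m]; ring
  rw [hcard] at hN
  refine ⟨N, hN.trans (two_mul_choose_le m).2, v, fun i => (hv i).1, ?_⟩
  intro Θ hS hR x t ht hxt
  obtain ⟨z, hz⟩ := logits_sub_eq_quadMap X Ω s S hS hR
  set Δ : Ω → ℝ := fun e => logits X Ω Θ e - s e with hΔ
  set L := Real.sqrt (∑ e, Δ e ^ 2) with hL
  have hL2 : L ^ 2 = ∑ e, Δ e ^ 2 := Real.sq_sqrt (Finset.sum_nonneg fun _ _ => sq_nonneg _)
  -- A zero difference cannot be normalised, but then the form vanishes.
  rcases (Real.sqrt_nonneg (∑ e, Δ e ^ 2)).eq_or_lt with h0 | hpos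
  · have hz0 : ∀ e, Δ e = 0 := fun e => by
      have h1 : Δ e ^ 2 ≤ ∑ e, Δ e ^ 2 :=
        Finset.single_le_sum (f := fun e => Δ e ^ 2) (fun _ _ => sq_nonneg _) (Finset.mem_univ e)
      rw [← hL2, hL, ← h0] at h1
      exact pow_eq_zero_iff two_ne_zero |>.mp (le_antisymm (by simpa using h1) (sq_nonneg _))
    have : ∑ e, x e * Δ e = 0 := Finset.sum_eq_zero fun e _ => by rw [hz0, mul_zero]
    rw [this, abs_zero]
    positivity
  · rw [← hL] at hpos
    have hmem : (fun e => L⁻¹ * Δ e) ∈ 𝒱 := by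
      refine ⟨?_, L⁻¹, z, funext fun e => by rw [← hz e]⟩
      simp_rw [mul_pow]
      rw [← Finset.mul_sum, ← hL2]
      field_simp
    have h1 := hw _ hmem x
    have h2 : ∑ i, |∑ e, x e * v i e| ^ (m + 1) ≤ N * t ^ (m + 1) := by
      calc _ ≤ ∑ _i : Fin N, t ^ (m + 1) := Finset.sum_le_sum fun i _ =>
            pow_le_pow_left₀ (abs_nonneg _) (hxt i) _
        _ = _ := by simp
    have h3 : (2 * N : ℝ) ≤ 32 ^ (m + 1) := by
      exact_mod_cast (Nat.mul_le_mul_left 2 hN).trans (two_mul_choose_le m).1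
    have h4 : |∑ e, x e * (L⁻¹ * Δ e)| ^ (m + 1) ≤ (32 * t) ^ (m + 1) := by
      calc _ ≤ 2 * (N * t ^ (m + 1)) := h1.trans (by gcongr)
        _ = 2 * N * t ^ (m + 1) := by ring
        _ ≤ 32 ^ (m + 1) * t ^ (m + 1) := by gcongr
        _ = _ := by rw [mul_pow]
    have h5 := le_of_pow_le_pow_left₀ (Nat.succ_ne_zero m) (by positivity) h4
    have h6 : ∑ e, x e * (L⁻¹ * Δ e) = L⁻¹ * ∑ e, x e * Δ e := by
      rw [Finset.mul_sum]
      exact Finset.sum_congr rfl fun e _ => by ring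
    rw [h6, abs_mul, abs_of_pos (inv_pos.mpr hpos), inv_mul_le_iff₀ hpos] at h5
    linarith

end LowRank

/-! ### Tails of the noise in a single direction. -/

/-- With `u = |x| - √τ ≥ 0` the left side is `u² + 2√τ u`, and the exponential dominates its
quadratic Taylor polynomial at `√τ u / 2`. The slope `√τ / 2` minimises `a² - a √τ`, the exponent
left after the bound `exp (a²)` on the exponential moment. -/
lemma sq_sub_le_exp {τ : ℝ} (hτ : 1 ≤ τ) (x : ℝ) :
    max (x ^ 2 - τ) 0 ≤ 8 * Real.exp (√τ / 2 * |x| - τ / 2) := by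
  have hs := Real.sq_sqrt (zero_le_one.trans hτ)
  have hs0 := Real.sqrt_nonneg τ
  refine max_le ?_ (by positivity)
  rcases le_total (√τ) |x| with h | h
  · have h1 := Real.quadratic_le_exp_of_nonneg (x := √τ / 2 * |x| - τ / 2) (by nlinarith)
    have h2 : √τ / 2 * |x| - τ / 2 = √τ / 2 * (|x| - √τ) := by nlinarith
    rw [h2] at h1 ⊢
    set u := |x| - √τ with hu
    have hu0 : 0 ≤ u := by linarith
    have hx : x ^ 2 - τ = u ^ 2 + 2 * √τ * u := by rw [← sq_abs x, ← hs, hu, hs]; ring_nf; linarith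
    have h3 : u ^ 2 ≤ τ * u ^ 2 := by nlinarith [sq_nonneg u]
    have h4 : (√τ / 2 * u) ^ 2 = τ * u ^ 2 / 4 := by rw [mul_pow, div_pow, hs]; ring
    rw [h4] at h1
    nlinarith [mul_nonneg hs0 hu0]
  · have : x ^ 2 ≤ τ := by rw [← sq_abs, ← hs]; gcongr
    have := Real.exp_pos (√τ / 2 * |x| - τ / 2)
    linarith

section Noise

variable {E : Type*} [Fintype E] [DecidableEq E]

lemma sum_bernWeight_max_le (s v : E → ℝ) (hv : ∑ e, v e ^ 2 = 1) {τ : ℝ} (hτ : 1 ≤ τ) :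
    ∑ y, bernWeight s y * max ((∑ e, noise s y e * v e) ^ 2 - τ) 0 ≤
      16 * Real.exp (-(τ / 4)) := by
  have hs := Real.sq_sqrt (zero_le_one.trans hτ)
  set a := √τ / 2
  have ha : a ^ 2 = τ / 4 := by simp only [a]; rw [div_pow, hs]; ring
  have hb : ∀ y, bernWeight s y * max ((∑ e, noise s y e * v e) ^ 2 - τ) 0 ≤
      8 * Real.exp (-(τ / 2)) * (bernWeight s y * Real.exp (∑ e, (a * v e) * noise s y e) +
        bernWeight s y * Real.exp (∑ e, (-a * v e) * noise s y e)) := by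
    intro y
    set x := ∑ e, noise s y e * v e with hx
    have e1 : ∑ e, (a * v e) * noise s y e = a * x := by
      rw [hx, Finset.mul_sum]; exact Finset.sum_congr rfl fun e _ => by ring
    have e2 : ∑ e, (-a * v e) * noise s y e = -(a * x) := by
      rw [hx, Finset.mul_sum, ← Finset.sum_neg_distrib]
      exact Finset.sum_congr rfl fun e _ => by ring
    rw [e1, e2]
    have h1 := sq_sub_le_exp hτ x
    have h2 : Real.exp (a * |x| - τ / 2) ≤
        Real.exp (-(τ / 2)) * (Real.exp (a * x) + Real.exp (-(a * x))) := by
      rw [sub_eq_neg_add, Real.exp_add]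
      gcongr
      rcases abs_cases x with ⟨h, _⟩ | ⟨h, _⟩ <;> rw [h]
      · linarith [Real.exp_pos (-(a * x))]
      · rw [mul_neg]; linarith [Real.exp_pos (a * x)]
    have h3 := bernWeight_pos s y
    calc _ ≤ bernWeight s y * (8 * (Real.exp (-(τ / 2)) *
          (Real.exp (a * x) + Real.exp (-(a * x))))) := by
          gcongr
          exact h1.trans (by gcongr)
      _ = _ := by ring
  refine (Finset.sum_le_sum fun y _ => hb y).trans ?_
  rw [← Finset.mul_sum, Finset.sum_add_distrib]
  have m1 := sum_bernWeight_mul_exp_le s fun e => a * v e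
  have m2 := sum_bernWeight_mul_exp_le s fun e => -a * v e
  simp_rw [mul_pow, neg_sq, ← Finset.mul_sum, hv, ha, mul_one] at m1 m2
  calc _ ≤ 8 * Real.exp (-(τ / 2)) * (Real.exp (τ / 4) + Real.exp (τ / 4)) := by gcongr
    _ = 16 * (Real.exp (-(τ / 2)) * Real.exp (τ / 4)) := by ring
    _ = _ := by rw [← Real.exp_add]; congr 2; ring

end Noise

/-! ### The penalty function and the union bound. -/

lemma le_mul_log {d K : ℕ} (hK : K ≤ d) : (K : ℝ) ≤ K * Real.log (d * Real.exp 1 / K) := by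
  rcases Nat.eq_zero_or_pos K with rfl | h
  · simp
  · have hK0 : (0 : ℝ) < K := by exact_mod_cast h
    have hd : (K : ℝ) ≤ d := by exact_mod_cast hK
    have hd0 : (0 : ℝ) < d := hK0.trans_le hd
    have h1 : 1 ≤ Real.log (d * Real.exp 1 / K) := by
      rw [Real.le_log_iff_exp_le (by positivity), le_div_iff₀ hK0]
      nlinarith [Real.exp_pos 1]
    nlinarith

/-- The function `x log(de/x)` has derivative `log(d/x) ≥ 0` on `(0, d]`. The discrete proof
combines `log u ≤ u - 1` with `log(de/k) ≥ 1`. -/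
lemma mul_log_mono {d K k : ℕ} (hKk : K ≤ k) (hk : k ≤ d) :
    (K : ℝ) * Real.log (d * Real.exp 1 / K) ≤ k * Real.log (d * Real.exp 1 / k) := by
  rcases Nat.eq_zero_or_pos K with rfl | h
  · simpa using (Nat.cast_nonneg k).trans (le_mul_log hk)
  · have hK0 : (0 : ℝ) < K := by exact_mod_cast h
    have hk0 : (0 : ℝ) < k := by exact_mod_cast h.trans_le hKk
    have hd0 : (0 : ℝ) < d := by exact_mod_cast h.trans_le (hKk.trans hk)
    have hKk' : (K : ℝ) ≤ k := by exact_mod_cast hKk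
    have h1 : Real.log (d * Real.exp 1 / K) =
        Real.log (d * Real.exp 1 / k) + Real.log (k / K) := by
      rw [← Real.log_mul (by positivity) (by positivity)]
      congr 1
      field_simp
    have h2 : Real.log (k / K) ≤ k / K - 1 := Real.log_le_sub_one_of_pos (by positivity)
    have h3 : 1 ≤ Real.log (d * Real.exp 1 / k) := by
      have := le_mul_log hk
      by_contra hlt
      nlinarith
    have h4 : (K : ℝ) * Real.log (k / K) ≤ k - K := by
      calc (K : ℝ) * Real.log (k / K) ≤ K * (k / K - 1) := by gcongr
        _ = k - K := by field_simp
    rw [h1]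
    nlinarith

lemma penFun_mono {c : ℝ} (hc : 0 ≤ c) {d R K r k : ℕ} (hR : R ≤ r) (hK : K ≤ k) (hk : k ≤ d) :
    penFun c d R K ≤ penFun c d r k := by
  have h := mul_log_mono hK hk
  have h2 : (K : ℝ) * R ≤ k * r := by exact_mod_cast Nat.mul_le_mul hK hR
  unfold penFun
  nlinarith

lemma choose_le_exp_mul_log {d K : ℕ} (hK : K ≤ d) :
    (d.choose K : ℝ) ≤ Real.exp (K * Real.log (d * Real.exp 1 / K)) := by
  rcases Nat.eq_zero_or_pos K with rfl | h
  · simp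
  · have hK0 : (0 : ℝ) < K := by exact_mod_cast h
    have hd0 : (0 : ℝ) < d := by exact_mod_cast h.trans_le hK
    have h1 : (d.choose K : ℝ) ≤ d ^ K / K.factorial := Nat.choose_le_pow_div K d
    have h2 : (K : ℝ) ^ K / K.factorial ≤ Real.exp K :=
      Real.pow_div_factorial_le_exp _ hK0.le _
    have hf : (0 : ℝ) < K.factorial := by exact_mod_cast K.factorial_pos
    have h3 : Real.exp (K * Real.log (d * Real.exp 1 / K)) = (d / K) ^ K * Real.exp K := by
      rw [mul_comm, Real.exp_mul, Real.exp_log (by positivity), Real.rpow_natCast,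
        mul_div_right_comm, mul_pow, ← Real.exp_nat_mul, mul_one]
    rw [h3]
    refine h1.trans ?_
    calc (d : ℝ) ^ K / K.factorial = (d / K) ^ K * (K ^ K / K.factorial) := by
          rw [div_pow]; field_simp
      _ ≤ _ := by gcongr

/-- The threshold for the squared noise in the directions of rank `R` supported on `K` rows. -/
def noiseLevel (d R K : ℕ) : ℝ := 32 * (1 + penFun 1 d R K)

lemma penFun_one_ge {d R K : ℕ} (hK : K ≤ d) : (K : ℝ) ≤ penFun 1 d R K := by
  have h := le_mul_log hK
  have : (0 : ℝ) ≤ K * R := by positivity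
  simp only [penFun, one_mul]
  linarith

lemma one_le_noiseLevel {d R K : ℕ} (hK : K ≤ d) : 1 ≤ noiseLevel d R K := by
  have h1 := penFun_one_ge (R := R) hK
  have : (0 : ℝ) ≤ K := by positivity
  unfold noiseLevel
  linarith

/-- The factor `32` in `noiseLevel` is set here: a quarter of the level is `8 (1 + KR + K
log(de/K))`, against a cost of `K log(de/K)` for the supports and `3 (KR + 1)` for the directions.
-/
lemma card_mul_exp_noiseLevel_le {d K R : ℕ} (hK : K ≤ d) :
    (d.choose K : ℝ) * (16 ^ (K * R + 1) * Real.exp (-(noiseLevel d R K / 4))) ≤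
      Real.exp (-(7 * K)) / Real.exp 5 := by
  have h16 : (16 : ℝ) ^ (K * R + 1) ≤ Real.exp (3 * (K * R + 1)) := by
    have h : (16 : ℝ) ≤ Real.exp 3 := by
      have h1 := Real.exp_one_gt_d9
      have : Real.exp 3 = Real.exp 1 ^ 3 := by rw [← Real.exp_nat_mul]; norm_num
      rw [this]
      calc (16 : ℝ) ≤ 2.7 ^ 3 := by norm_num
        _ ≤ _ := by gcongr; linarith
    calc (16 : ℝ) ^ (K * R + 1) ≤ Real.exp 3 ^ (K * R + 1) := by gcongr
      _ = _ := by rw [← Real.exp_nat_mul]; congr 1; push_cast; ring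
  have hL := le_mul_log hK
  have hKR : (0 : ℝ) ≤ K * R := by positivity
  calc _ ≤ Real.exp (K * Real.log (d * Real.exp 1 / K)) * (Real.exp (3 * (K * R + 1)) *
        Real.exp (-(noiseLevel d R K / 4))) := by
        gcongr
        exact choose_le_exp_mul_log hK
    _ = Real.exp (K * Real.log (d * Real.exp 1 / K) + (3 * (K * R + 1) +
        -(noiseLevel d R K / 4))) := by rw [Real.exp_add, Real.exp_add]
    _ ≤ Real.exp (-(7 * K) - 5) := by
        rw [Real.exp_le_exp]
        simp only [noiseLevel, penFun, one_mul]
        linarith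
    _ = _ := Real.exp_sub _ _

lemma sum_card_mul_exp_noiseLevel_le (d : ℕ) :
    ∑ S : Finset (Fin d), ∑ R ∈ Finset.range (S.card + 1),
      (16 : ℝ) ^ (S.card * R + 1) * (16 * Real.exp (-(noiseLevel d R S.card / 4))) ≤ 32 := by
  have h1 : ∑ S : Finset (Fin d), ∑ R ∈ Finset.range (S.card + 1),
      (16 : ℝ) ^ (S.card * R + 1) * (16 * Real.exp (-(noiseLevel d R S.card / 4))) =
      ∑ K ∈ Finset.range (d + 1), d.choose K • ∑ R ∈ Finset.range (K + 1),
        (16 : ℝ) ^ (K * R + 1) * (16 * Real.exp (-(noiseLevel d R K / 4))) := by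
    rw [← Finset.powerset_univ, Finset.sum_powerset_apply_card (fun K =>
      ∑ R ∈ Finset.range (K + 1),
        (16 : ℝ) ^ (K * R + 1) * (16 * Real.exp (-(noiseLevel d R K / 4))))]
    simp
  rw [h1]
  have hterm : ∀ K ∈ Finset.range (d + 1), d.choose K • ∑ R ∈ Finset.range (K + 1),
        (16 : ℝ) ^ (K * R + 1) * (16 * Real.exp (-(noiseLevel d R K / 4))) ≤
        16 * (1 / 2) ^ K := by
    intro K hK
    have hKd : K ≤ d := by simpa [Nat.lt_succ_iff] using hK
    rw [nsmul_eq_mul, Finset.mul_sum]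
    have h2 : (K : ℝ) + 1 ≤ Real.exp K := Real.add_one_le_exp _
    have h3 : (1 : ℝ) ≤ Real.exp 5 := Real.one_le_exp (by norm_num)
    calc _ ≤ ∑ R ∈ Finset.range (K + 1), 16 * Real.exp (-(7 * K)) := by
          refine Finset.sum_le_sum fun R _ => ?_
          have h4 := card_mul_exp_noiseLevel_le (R := R) hKd
          have h5 : Real.exp (-(7 * K)) / Real.exp 5 ≤ Real.exp (-(7 * K)) :=
            div_le_self (Real.exp_pos _).le h3
          calc _ = 16 * ((d.choose K : ℝ) * (16 ^ (K * R + 1) *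
                Real.exp (-(noiseLevel d R K / 4)))) := by ring
            _ ≤ _ := by linarith
      _ = 16 * (((K : ℝ) + 1) * Real.exp (-(7 * K))) := by simp; ring
      -- The `K + 1` possible ranks cost at most `exp K`, and a geometric series in `K` remains.
      _ ≤ 16 * (Real.exp K * Real.exp (-(7 * K))) := by gcongr
      _ = 16 * Real.exp (-6) ^ K := by
          rw [← Real.exp_add, ← Real.exp_nat_mul]; congr 2; ring
      _ ≤ _ := by
          gcongr
          rw [Real.exp_neg, one_div]
          gcongr
          linarith [Real.add_one_le_exp (6 : ℝ)]
  refine (Finset.sum_le_sum hterm).trans ?_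
  rw [← Finset.mul_sum]
  have : ∑ K ∈ Finset.range (d + 1), (1 / 2 : ℝ) ^ K ≤ 2 := by
    have := sum_geometric_two_le (d + 1)
    simpa using this
  linarith

/-! ### Row supports and rank. -/

section Support

variable {d : ℕ}

/-- The set of nonzero rows. -/
def rowSupport (Θ : Matrix (Fin d) (Fin d) ℝ) : Finset (Fin d) := by
  classical exact Finset.univ.filter fun i => Θ i ≠ 0

lemma card_rowSupport (Θ : Matrix (Fin d) (Fin d) ℝ) : (rowSupport Θ).card = norm00 Θ := by
  classical
  rw [norm00, rowSupport, Set.ncard_eq_toFinset_card']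
  congr 1
  ext i
  simp

lemma mem_rowSupport_of_ne {Θ : Matrix (Fin d) (Fin d) ℝ} (hΘ : Θ.IsSymm) {a b : Fin d}
    (h : Θ a b ≠ 0) : a ∈ rowSupport Θ ∧ b ∈ rowSupport Θ := by
  have h2 : Θ b a ≠ 0 := by rwa [hΘ.apply]
  simp only [rowSupport, Finset.mem_filter, Finset.mem_univ, true_and]
  exact ⟨fun h0 => h (by rw [h0]; rfl), fun h0 => h2 (by rw [h0]; rfl)⟩

lemma norm00_le (Θ : Matrix (Fin d) (Fin d) ℝ) : norm00 Θ ≤ d := by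
  rw [← card_rowSupport]
  simpa using Finset.card_le_univ (rowSupport Θ)

lemma rank_le_norm00 (Θ : Matrix (Fin d) (Fin d) ℝ) : Θ.rank ≤ norm00 Θ := by
  classical
  rw [Matrix.rank_eq_finrank_span_row, ← card_rowSupport]
  have h : Submodule.span ℝ (Set.range Θ.row) ≤
      Submodule.span ℝ ((rowSupport Θ).image Θ.row : Set (Fin d → ℝ)) := by
    rw [Submodule.span_le]
    rintro _ ⟨i, rfl⟩
    by_cases hi : Θ i = 0
    · have : Θ.row i = 0 := hi
      rw [this]
      exact Submodule.zero_mem _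
    · refine Submodule.subset_span ?_
      rw [Finset.coe_image]
      exact ⟨i, by simp [rowSupport, hi], rfl⟩
  calc _ ≤ _ := Submodule.finrank_mono h
    _ ≤ _ := finrank_span_finset_le_card _
    _ ≤ _ := Finset.card_image_le

end Support

/-! ### Risk bounds for the penalised estimator. -/

section Upper

variable {d n : ℕ} {X : Matrix (Fin d) (Fin n) ℝ} {Ω : Finset (Fin n × Fin n)} {M c : ℝ}

lemma abs_logits_le (hX : BoundedDesign X Ω M) {Θ : Matrix (Fin d) (Fin d) ℝ} (hs : Θ.IsSymm)
    (hM : norm11 Θ ≤ M) (hM0 : 0 < M) (e : Ω) : |logits X Ω Θ e| ≤ M := by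
  -- The design condition concerns the open ball, whereas the estimator may lie on its boundary:
  -- shrink by `u < 1`.
  have key : ∀ u ∈ Set.Ico (0 : ℝ) 1, u * |logits X Ω Θ e| ≤ M := by
    rintro u ⟨hu0, hu1⟩
    have h11 : norm11 (u • Θ) = u * norm11 Θ := by
      simp [norm11, abs_mul, abs_of_nonneg hu0, Finset.mul_sum]
    have hmem : u • Θ ∈ paramSpace d d d M := by
      refine ⟨hs.smul u, ?_, norm00_le _, (rank_le_norm00 _).trans (norm00_le _)⟩
      rw [h11]
      have : 0 ≤ norm11 Θ := Finset.sum_nonneg fun _ _ => Finset.sum_nonneg fun _ _ => abs_nonneg _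
      nlinarith
    have h := hX _ hmem e.1 e.2
    have h2 : affinity X (u • Θ) e.1.1 e.1.2 = u * logits X Ω Θ e := by
      simp [affinity, logits]
    rw [h2, abs_mul, abs_of_nonneg hu0] at h
    exact h.le
  by_contra! hlt
  have hpos : 0 < |logits X Ω Θ e| := hM0.trans hlt
  -- A factor strictly between `M / |t|` and `1`, where `t` is the logit; the shrunken logit has
  -- modulus `(M + |t|) / 2 > M`.
  have h := key ((M / |logits X Ω Θ e| + 1) / 2) ⟨by positivity, by
    have : M / |logits X Ω Θ e| < 1 := (div_lt_one hpos).mpr hlt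
    linarith⟩
  have h2 : (M / |logits X Ω Θ e| + 1) / 2 * |logits X Ω Θ e| = (M + |logits X Ω Θ e|) / 2 := by
    field_simp
  linarith

lemma frobSqOn_affinity_sub (Θ Θ' : Matrix (Fin d) (Fin d) ℝ) :
    frobSqOn Ω (affinity X Θ - affinity X Θ') =
      ∑ e, (logits X Ω Θ e - logits X Ω Θ' e) ^ 2 := by
  rw [frobSqOn, ← Finset.sum_coe_sort]
  rfl

lemma frobSqOn_nonneg (B : Matrix (Fin n) (Fin n) ℝ) : 0 ≤ frobSqOn Ω B :=
  Finset.sum_nonneg fun _ _ => sq_nonneg _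

variable (X Ω) in
/-- The Kullback–Leibler divergence of the laws at `Θ` and `Θ'`, as a real number. -/
def klSum (Θ Θ' : Matrix (Fin d) (Fin d) ℝ) : ℝ :=
  ∑ e, bernKL (logits X Ω Θ e) (logits X Ω Θ' e)

lemma curv_mul_frobSqOn_le_klSum (hX : BoundedDesign X Ω M) (hM0 : 0 < M)
    {Θ Θ' : Matrix (Fin d) (Fin d) ℝ} (hs : Θ.IsSymm) (hM : norm11 Θ ≤ M) (hs' : Θ'.IsSymm)
    (hM' : norm11 Θ' ≤ M) :
    curv M / 2 * frobSqOn Ω (affinity X Θ' - affinity X Θ) ≤ klSum X Ω Θ Θ' := by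
  rw [frobSqOn_affinity_sub, Finset.mul_sum]
  exact Finset.sum_le_sum fun e _ => curv_mul_sq_le_bernKL (abs_logits_le hX hs hM hM0 e)
    (abs_logits_le hX hs' hM' hM0 e)

lemma logLik_sub (y : Ω → Bool) (Θ Θ' : Matrix (Fin d) (Fin d) ℝ) :
    logLik X Ω y Θ - logLik X Ω y Θ' = klSum X Ω Θ Θ' -
      ∑ e, noise (logits X Ω Θ) y e * (logits X Ω Θ' e - logits X Ω Θ e) := by
  rw [logLik_eq, logLik_eq, log_bernWeight_sub, klSum]

/-- The excess of the squared noise over its level is controlled by a random variable of bounded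
mean, uniformly over all sparsity patterns and ranks. -/
lemma exists_excess (Θ : Matrix (Fin d) (Fin d) ℝ) :
    ∃ W : (Ω → Bool) → ℝ, (∀ y, 0 ≤ W y) ∧
      ∑ y, bernWeight (logits X Ω Θ) y * W y ≤ 32 ∧
      ∀ (y : Ω → Bool) (Θ' : Matrix (Fin d) (Fin d) ℝ), Θ'.IsSymm →
        |∑ e, noise (logits X Ω Θ) y e * (logits X Ω Θ' e - logits X Ω Θ e)| ≤
          32 * √(noiseLevel d Θ'.rank (norm00 Θ') + W y) *
            √(∑ e, (logits X Ω Θ' e - logits X Ω Θ e) ^ 2) := by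
  set s := logits X Ω Θ with hs
  choose N hN v hv hw using fun (S : Finset (Fin d)) (R : ℕ) => exists_lowRank_points X Ω s S R
  let f : Finset (Fin d) → ℕ → (Ω → Bool) → ℝ := fun S R y =>
    ∑ i, max ((∑ e, noise s y e * v S R i e) ^ 2 - noiseLevel d R S.card) 0
  have hf : ∀ S R y, 0 ≤ f S R y := fun S R y => Finset.sum_nonneg fun _ _ => le_max_right _ _
  have hcard : ∀ S : Finset (Fin d), S.card ≤ d := fun S => by simpa using Finset.card_le_univ S
  -- A sum of positive parts dominates each excess and makes the union bound a bound in mean. Ranks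
  -- up to `|S|` suffice, since the rank is at most the number of nonzero rows.
  refine ⟨fun y => ∑ S, ∑ R ∈ Finset.range (S.card + 1), f S R y,
    fun y => Finset.sum_nonneg fun S _ => Finset.sum_nonneg fun R _ => hf S R y, ?_, ?_⟩
  · refine le_trans ?_ (sum_card_mul_exp_noiseLevel_le d)
    simp_rw [Finset.mul_sum]
    rw [Finset.sum_comm]
    refine Finset.sum_le_sum fun S _ => ?_
    rw [Finset.sum_comm]
    refine Finset.sum_le_sum fun R _ => ?_
    simp only [f, Finset.mul_sum]
    rw [Finset.sum_comm]
    calc _ ≤ ∑ _i : Fin (N S R), 16 * Real.exp (-(noiseLevel d R S.card / 4)) :=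
          Finset.sum_le_sum fun i _ => sum_bernWeight_max_le s (v S R i) (hv S R i)
            (one_le_noiseLevel (hcard S))
      _ = N S R * (16 * Real.exp (-(noiseLevel d R S.card / 4))) := by simp
      _ ≤ _ := by
        gcongr
        exact_mod_cast hN S R
  · intro y Θ' hΘ'
    set S := rowSupport Θ'
    have hR : Θ'.rank ∈ Finset.range (S.card + 1) := by
      rw [Finset.mem_range, Nat.lt_succ_iff, card_rowSupport]
      exact rank_le_norm00 Θ'
    have hle : f S Θ'.rank y ≤ ∑ S, ∑ R ∈ Finset.range (S.card + 1), f S R y := by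
      calc f S Θ'.rank y ≤ ∑ R ∈ Finset.range (S.card + 1), f S R y :=
            Finset.single_le_sum (f := fun R => f S R y) (fun R _ => hf S R y) hR
        _ ≤ _ := Finset.single_le_sum
            (f := fun S => ∑ R ∈ Finset.range (S.card + 1), f S R y)
            (fun S _ => Finset.sum_nonneg fun R _ => hf S R y) (Finset.mem_univ S)
    refine hw S Θ'.rank Θ' (fun a b h => mem_rowSupport_of_ne hΘ' h) rfl _ _ (Real.sqrt_nonneg _)
      fun i => Real.abs_le_sqrt ?_
    have h1 : max ((∑ e, noise s y e * v S Θ'.rank i e) ^ 2 - noiseLevel d Θ'.rank S.card) 0 ≤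
        f S Θ'.rank y :=
      Finset.single_le_sum (f := fun i => max ((∑ e, noise s y e * v S Θ'.rank i e) ^ 2 -
        noiseLevel d Θ'.rank S.card) 0) (fun _ _ => le_max_right _ _) (Finset.mem_univ i)
    have h2 := le_max_left ((∑ e, noise s y e * v S Θ'.rank i e) ^ 2 -
      noiseLevel d Θ'.rank S.card) 0
    rw [← card_rowSupport]
    linarith

lemma sum_klSum_le (hM0 : 0 < M) (hc : 32768 / curv M ≤ c) (hX : BoundedDesign X Ω M)
    {Θhat : (Ω → Bool) → Matrix (Fin d) (Fin d) ℝ} (hhat : IsPenalizedMLE c M X Ω Θhat)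
    {Θ : Matrix (Fin d) (Fin d) ℝ} (hΘ : Θ ∈ paramSpace d d d M) :
    ∑ y, bernWeight (logits X Ω Θ) y * klSum X Ω Θ (Θhat y) ≤ 4 * c + 2 * pen c Θ := by
  obtain ⟨W, hW0, hW, hWle⟩ := exists_excess (X := X) (Ω := Ω) Θ
  have hcurv := curv_pos M
  have hc0 : 0 < c := lt_of_lt_of_le (by positivity) hc
  have hpt : ∀ y, klSum X Ω Θ (Θhat y) ≤ 2 * c + c / 16 * W y + 2 * pen c Θ := by
    intro y
    obtain ⟨hsymm, hnorm, hmin⟩ := hhat y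
    have h1 := hmin Θ hΘ
    have h2 := logLik_sub y Θ (Θhat y) (X := X)
    have h3 := (abs_le.mp (hWle y (Θhat y) hsymm)).2
    have h4 := curv_mul_frobSqOn_le_klSum hX hM0 hΘ.1 hΘ.2.1.le hsymm hnorm
    rw [frobSqOn_affinity_sub] at h4
    set Q := ∑ e, (logits X Ω (Θhat y) e - logits X Ω Θ e) ^ 2
    have hQ : √Q ^ 2 = Q := Real.sq_sqrt (Finset.sum_nonneg fun _ _ => sq_nonneg _)
    set T := noiseLevel d (Θhat y).rank (norm00 (Θhat y)) + W y with hT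
    have hTnn : 0 ≤ T := by
      have := one_le_noiseLevel (R := (Θhat y).rank) (norm00_le (Θhat y))
      linarith [hW0 y]
    have hTs : √T ^ 2 = T := Real.sq_sqrt hTnn
    -- Completing the square spends `curv M / 4 * Q`, half of the lower bound for the divergence.
    have h5 : 32 * √T * √Q ≤ curv M / 4 * Q + 1024 * T / curv M := by
      have : curv M / 4 * Q + 1024 * T / curv M - 32 * √T * √Q =
          (curv M * √Q - 64 * √T) ^ 2 / (4 * curv M) := by
        rw [sub_sq, mul_pow, mul_pow, hQ, hTs]
        field_simp
        ring
      have h0 : 0 ≤ (curv M * √Q - 64 * √T) ^ 2 / (4 * curv M) := by positivity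
      linarith
    -- Here `32768 = 1024 * 32`; the `32` cancels the one in `noiseLevel`, so that exactly `pen c
    -- (Θhat y)` appears in `h7`.
    have h6 : 1024 * T / curv M ≤ c / 32 * T := by
      have : 1024 * T / curv M = 32768 / curv M * (T / 32) := by ring
      rw [this]
      calc _ ≤ c * (T / 32) := by gcongr
        _ = _ := by ring
    have h7 : c / 32 * T = c + pen c (Θhat y) + c / 32 * W y := by
      simp only [hT, noiseLevel, pen, penFun]
      ring
    linarith
  calc _ ≤ ∑ y, bernWeight (logits X Ω Θ) y * (2 * c + c / 16 * W y + 2 * pen c Θ) :=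
        Finset.sum_le_sum fun y _ => mul_le_mul_of_nonneg_left (hpt y) (bernWeight_pos _ _).le
    _ = (∑ y, bernWeight (logits X Ω Θ) y) * (2 * c + 2 * pen c Θ) +
        c / 16 * ∑ y, bernWeight (logits X Ω Θ) y * W y := by
      rw [Finset.sum_mul, Finset.mul_sum, ← Finset.sum_add_distrib]
      exact Finset.sum_congr rfl fun y _ => by ring
    _ ≤ 1 * (2 * c + 2 * pen c Θ) + c / 16 * 32 := by
      rw [sum_bernWeight]
      gcongr
    _ = _ := by ring

lemma pen_eq_mul_rate {N d k r : ℕ} (hN : 0 < N) :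
    penFun c d r k = c * (N * rate N d k r) := by
  have : (N : ℝ) ≠ 0 := by positivity
  rw [penFun, rate]
  field_simp

lemma sum_klSum_le_rate (hM0 : 0 < M) (hc : 32768 / curv M ≤ c) (hΩ : Ω.Nonempty)
    (hX : BoundedDesign X Ω M) {k r : ℕ} (hk : 1 ≤ k) (hkd : k ≤ d) (hr : 1 ≤ r)
    {Θhat : (Ω → Bool) → Matrix (Fin d) (Fin d) ℝ} (hhat : IsPenalizedMLE c M X Ω Θhat)
    {Θ : Matrix (Fin d) (Fin d) ℝ} (hΘ : Θ ∈ paramSpace d k r M) :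
    ∑ y, bernWeight (logits X Ω Θ) y * klSum X Ω Θ (Θhat y) ≤
      4 * c * (Ω.card * rate Ω.card d k r) := by
  have hc0 : 0 < c := lt_of_lt_of_le (by have := curv_pos M; positivity) hc
  have h1 := sum_klSum_le hM0 hc hX hhat (Θ := Θ)
    ⟨hΘ.1, hΘ.2.1, norm00_le _, (rank_le_norm00 _).trans (norm00_le _)⟩
  have h2 : pen c Θ ≤ penFun c d r k := penFun_mono hc0.le hΘ.2.2.2 hΘ.2.2.1 hkd
  rw [pen_eq_mul_rate hΩ.card_pos] at h2
  -- Both `k r` and `k log(de/k)` are at least `1`, so the additive `4 * c` is absorbed by the rate.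
  have h3 : (2 : ℝ) ≤ Ω.card * rate Ω.card d k r := by
    have h4 := pen_eq_mul_rate (c := 1) (d := d) (k := k) (r := r) hΩ.card_pos
    have h5 := le_mul_log hkd
    have h6 : (1 : ℝ) ≤ k := by exact_mod_cast hk
    have h7 : (1 : ℝ) ≤ k * r := by exact_mod_cast Nat.mul_pos hk hr
    simp only [penFun, one_mul] at h4
    linarith
  nlinarith

lemma klSum_nonneg (hX : BoundedDesign X Ω M) (hM0 : 0 < M)
    {Θ Θ' : Matrix (Fin d) (Fin d) ℝ} (hs : Θ.IsSymm) (hM : norm11 Θ ≤ M) (hs' : Θ'.IsSymm)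
    (hM' : norm11 Θ' ≤ M) : 0 ≤ klSum X Ω Θ Θ' := by
  refine le_trans ?_ (curv_mul_frobSqOn_le_klSum hX hM0 hs hM hs' hM')
  have := curv_pos M
  have : 0 ≤ frobSqOn Ω (affinity X Θ' - affinity X Θ) := frobSqOn_nonneg _
  positivity

lemma klRisk_le (hM0 : 0 < M) (hc : 32768 / curv M ≤ c) (hΩ : Ω.Nonempty)
    (hX : BoundedDesign X Ω M) {k r : ℕ} (hk : 1 ≤ k) (hkd : k ≤ d) (hr : 1 ≤ r)
    {Θhat : (Ω → Bool) → Matrix (Fin d) (Fin d) ℝ} (hhat : IsPenalizedMLE c M X Ω Θhat)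
    {Θ : Matrix (Fin d) (Fin d) ℝ} (hΘ : Θ ∈ paramSpace d k r M) :
    klRisk X Ω Θhat Θ ≤ ENNReal.ofReal (4 * c * rate Ω.card d k r) := by
  have hN : (0 : ℝ) < Ω.card := by exact_mod_cast hΩ.card_pos
  have h := sum_klSum_le_rate hM0 hc hΩ hX hk hkd hr hhat hΘ
  have h0 : ∀ y, 0 ≤ klSum X Ω Θ (Θhat y) := fun y =>
    klSum_nonneg hX hM0 hΘ.1 hΘ.2.1.le (hhat y).1 (hhat y).2.1
  simp_rw [klRisk, klDiv_law]
  change (∫⁻ y, ENNReal.ofReal (klSum X Ω Θ (Θhat y)) ∂_) / _ ≤ _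
  rw [lintegral_law_ofReal X Ω Θ _ h0, ← ENNReal.ofReal_natCast, ← ENNReal.ofReal_div_of_pos hN]
  refine ENNReal.ofReal_le_ofReal ?_
  rw [div_le_iff₀ hN]
  linarith

lemma predRisk_le (hM0 : 0 < M) (hc : 32768 / curv M ≤ c) (hΩ : Ω.Nonempty)
    (hX : BoundedDesign X Ω M) {k r : ℕ} (hk : 1 ≤ k) (hkd : k ≤ d) (hr : 1 ≤ r)
    {Θhat : (Ω → Bool) → Matrix (Fin d) (Fin d) ℝ} (hhat : IsPenalizedMLE c M X Ω Θhat)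
    {Θ : Matrix (Fin d) (Fin d) ℝ} (hΘ : Θ ∈ paramSpace d k r M) :
    predRisk X Ω (fun y => affinity X (Θhat y)) Θ ≤
      ENNReal.ofReal (4 * c / curv M * rate Ω.card d k r) := by
  have hN : (0 : ℝ) < Ω.card := by exact_mod_cast hΩ.card_pos
  have h := sum_klSum_le_rate hM0 hc hΩ hX hk hkd hr hhat hΘ
  have hcurv := curv_pos M
  rw [predRisk, lintegral_law_ofReal X Ω Θ _ fun y => frobSqOn_nonneg _,
    ← ENNReal.ofReal_natCast, ← ENNReal.ofReal_ofNat, ← ENNReal.ofReal_mul (by norm_num),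
    ← ENNReal.ofReal_div_of_pos (by positivity)]
  refine ENNReal.ofReal_le_ofReal ?_
  have h2 : curv M / 2 * ∑ y, bernWeight (logits X Ω Θ) y *
      frobSqOn Ω (affinity X (Θhat y) - affinity X Θ) ≤
      ∑ y, bernWeight (logits X Ω Θ) y * klSum X Ω Θ (Θhat y) := by
    rw [Finset.mul_sum]
    refine Finset.sum_le_sum fun y _ => ?_
    rw [mul_left_comm]
    exact mul_le_mul_of_nonneg_left (curv_mul_frobSqOn_le_klSum hX hM0 hΘ.1 hΘ.2.1.le (hhat y).1
      (hhat y).2.1) (bernWeight_pos _ _).le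
  set A := ∑ y, bernWeight (logits X Ω Θ) y *
      frobSqOn Ω (affinity X (Θhat y) - affinity X Θ)
  rw [div_le_iff₀ (by positivity)]
  have h3 : A ≤ (4 * c * (Ω.card * rate Ω.card d k r)) / (curv M / 2) := by
    rw [le_div_iff₀ (by positivity)]
    linarith
  refine h3.trans (le_of_eq ?_)
  field_simp

end Upper

/-! ### Assouad's lemma over a finite alphabet. -/

section Assouad

variable {E J A : Type*} [Fintype E] [DecidableEq E] [Fintype J] [DecidableEq J] [Fintype A]
  [DecidableEq A]

omit [DecidableEq A] in
-- Swapping the letter at `j` with a fresh one is an involution, so resampling a letter preserves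
-- the uniform law on words.
lemma sum_update_eq (j : J) (G : (J → A) → ℝ) :
    ∑ ω, ∑ a, G (Function.update ω j a) = Fintype.card A * ∑ ω, G ω := by
  have hinv : Function.Involutive fun p : (J → A) × A => (Function.update p.1 j p.2, p.1 j) := by
    rintro ⟨ω, a⟩
    simp
  calc ∑ ω, ∑ a, G (Function.update ω j a) =
        ∑ p : (J → A) × A, G (hinv.toPerm _ p).1 :=
        (Fintype.sum_prod_type' fun ω a => G (Function.update ω j a)).symm
    _ = ∑ p : (J → A) × A, G p.1 := Equiv.sum_comp _ fun p : (J → A) × A => G p.1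
    _ = _ := by
      rw [Fintype.sum_prod_type]
      simp [Finset.mul_sum]

/-- By `p ≤ p² / (2Lq) + Lq / 2`, success under each law is compared with the reference law. The
events `T = a` partition the sample space, so the reference terms sum to `L / 2`. A chi-square
quantity of order `L` is allowed, hence `β` of order `log L`. -/
lemma sum_test_le {β : ℝ} (s : A → E → ℝ) (t : E → ℝ)
    (hβ : ∀ a, ∑ e, (s a e - t e) ^ 2 ≤ β) (hL : Real.exp (β / 4) ≤ 3 * Fintype.card A / 4)
    (T : (E → Bool) → A) :
    ∑ a, ∑ y, bernWeight (s a) y * (if T y = a then 1 else 0) ≤ 7 / 8 * Fintype.card A := by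
  set L : ℝ := (Fintype.card A : ℝ) with hLdef
  have hLpos : 0 < L := by
    have := Real.exp_pos (β / 4)
    linarith
  have hy : ∀ a y, bernWeight (s a) y * (if T y = a then (1 : ℝ) else 0) ≤
      1 / (2 * L) * (bernWeight (s a) y ^ 2 / bernWeight t y) +
        L / 2 * (bernWeight t y * (if T y = a then 1 else 0)) := by
    intro a y
    have h1 := bernWeight_pos (s a) y
    have h2 := bernWeight_pos t y
    set p := bernWeight (s a) y
    set q := bernWeight t y
    have h3 : p ≤ 1 / (2 * L) * (p ^ 2 / q) + L / 2 * q := by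
      have : 1 / (2 * L) * (p ^ 2 / q) + L / 2 * q - p = (p - L * q) ^ 2 / (2 * L * q) := by
        field_simp
        ring
      have : 0 ≤ (p - L * q) ^ 2 / (2 * L * q) := by positivity
      linarith
    split_ifs
    · simpa using h3
    · rw [mul_zero, mul_zero, mul_zero]
      positivity
  have hchi : ∀ a, ∑ y, bernWeight (s a) y ^ 2 / bernWeight t y ≤ 3 * L / 4 := by
    intro a
    refine (sum_bernWeight_sq_div_le (s a) t).trans (le_trans ?_ hL)
    rw [Real.exp_le_exp, ← Finset.sum_div]
    linarith [hβ a]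
  have hone : ∑ a, ∑ y, bernWeight t y * (if T y = a then (1 : ℝ) else 0) = 1 := by
    rw [Finset.sum_comm]
    simp [sum_bernWeight]
  calc _ ≤ ∑ a, ∑ y, (1 / (2 * L) * (bernWeight (s a) y ^ 2 / bernWeight t y) +
        L / 2 * (bernWeight t y * (if T y = a then 1 else 0))) :=
        Finset.sum_le_sum fun a _ => Finset.sum_le_sum fun y _ => hy a y
    _ = 1 / (2 * L) * (∑ a, ∑ y, bernWeight (s a) y ^ 2 / bernWeight t y) +
        L / 2 * ∑ a, ∑ y, bernWeight t y * (if T y = a then (1 : ℝ) else 0) := by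
      simp_rw [Finset.sum_add_distrib, Finset.mul_sum]
    _ ≤ 1 / (2 * L) * (∑ _a : A, 3 * L / 4) + L / 2 * 1 := by
      rw [hone]
      gcongr with a
      exact hchi a
    _ = _ := by
      rw [Finset.sum_const, Finset.card_univ, nsmul_eq_mul, ← hLdef]
      field_simp
      ring

/-- Assouad's lemma over a finite alphabet `A`, for products of Bernoulli laws. -/
lemma exists_le_risk [Nonempty A] {α β : ℝ} (hα : 0 ≤ α) (θ : (J → A) → E → ℝ)
    (hsep : ∀ ω ω', α * (∑ j, if ω j = ω' j then 0 else 1) ≤ ∑ e, (θ ω e - θ ω' e) ^ 2)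
    (hβ : ∀ ω j a, ∑ e, (θ (Function.update ω j a) e - θ ω e) ^ 2 ≤ β)
    (hL : Real.exp (β / 4) ≤ 3 * Fintype.card A / 4) (S : (E → Bool) → E → ℝ) :
    ∃ ω, α * Fintype.card J / 32 ≤
      ∑ y, bernWeight (θ ω) y * ∑ e, (S y e - θ ω e) ^ 2 := by
  -- Decode to a nearest codeword; the triangle inequality loses a factor `4`.
  choose T hT using fun y => Finite.exists_min fun ω => ∑ e, (S y e - θ ω e) ^ 2
  have hLpos : (0 : ℝ) < Fintype.card A := by exact_mod_cast Fintype.card_pos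
  have hloss : ∀ ω y, α / 4 * (∑ j, if T y j = ω j then 0 else 1) ≤
      ∑ e, (S y e - θ ω e) ^ 2 := by
    intro ω y
    have h1 : ∑ e, (θ (T y) e - θ ω e) ^ 2 ≤
        2 * ∑ e, (S y e - θ (T y) e) ^ 2 + 2 * ∑ e, (S y e - θ ω e) ^ 2 := by
      rw [Finset.mul_sum, Finset.mul_sum, ← Finset.sum_add_distrib]
      exact Finset.sum_le_sum fun e _ => by
        nlinarith [sq_nonneg (S y e - θ (T y) e + (S y e - θ ω e))]
    have h2 := hsep (T y) ω
    have h3 := hT y ω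
    linarith
  have htest : ∀ j, ∑ ω, ∑ y, bernWeight (θ ω) y * (if T y j = ω j then (1 : ℝ) else 0) ≤
      7 / 8 * Fintype.card (J → A) := by
    intro j
    have h1 := sum_update_eq j fun ω : J → A =>
      ∑ y, bernWeight (θ ω) y * (if T y j = ω j then (1 : ℝ) else 0)
    have h2 : ∑ ω, ∑ a, ∑ y, bernWeight (θ (Function.update ω j a)) y *
        (if T y j = Function.update ω j a j then (1 : ℝ) else 0) ≤
        ∑ _ω : J → A, 7 / 8 * (Fintype.card A : ℝ) := by
      refine Finset.sum_le_sum fun ω _ => ?_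
      simp only [Function.update_self]
      -- The word `ω` itself is the reference for testing among its modifications at `j`.
      exact sum_test_le (fun a => θ (Function.update ω j a)) (θ ω) (hβ ω j) hL fun y => T y j
    rw [h1, Finset.sum_const, Finset.card_univ, nsmul_eq_mul] at h2
    nlinarith
  by_contra! hlt
  have hsum : ∑ ω, ∑ y, bernWeight (θ ω) y * ∑ e, (S y e - θ ω e) ^ 2 <
      ∑ _ω : J → A, α * Fintype.card J / 32 :=
    Finset.sum_lt_sum_of_nonempty Finset.univ_nonempty fun ω _ => hlt ω
  have hge : ∑ ω, ∑ y, bernWeight (θ ω) y * (α / 4 * (∑ j, if T y j = ω j then 0 else 1)) ≤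
      ∑ ω, ∑ y, bernWeight (θ ω) y * ∑ e, (S y e - θ ω e) ^ 2 :=
    Finset.sum_le_sum fun ω _ => Finset.sum_le_sum fun y _ =>
      mul_le_mul_of_nonneg_left (hloss ω y) (bernWeight_pos _ _).le
  have heq : ∑ ω, ∑ y, bernWeight (θ ω) y * (α / 4 * (∑ j, if T y j = ω j then 0 else 1)) =
      α / 4 * ∑ j, (Fintype.card (J → A) -
        ∑ ω, ∑ y, bernWeight (θ ω) y * (if T y j = ω j then (1 : ℝ) else 0)) := by
    have hc : (Fintype.card (J → A) : ℝ) = ∑ ω : J → A, ∑ y, bernWeight (θ ω) y := by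
      simp_rw [sum_bernWeight]
      simp
    rw [hc]
    have h1 : ∀ ω y, bernWeight (θ ω) y * (α / 4 * (∑ j, if T y j = ω j then 0 else 1)) =
        ∑ j, α / 4 * (bernWeight (θ ω) y -
          bernWeight (θ ω) y * (if T y j = ω j then (1 : ℝ) else 0)) := fun ω y => by
      rw [Finset.mul_sum, Finset.mul_sum]
      refine Finset.sum_congr rfl fun j _ => ?_
      split_ifs <;> ring
    simp_rw [h1, ← Finset.sum_sub_distrib, Finset.mul_sum]
    rw [Finset.sum_congr rfl fun ω _ => Finset.sum_comm, Finset.sum_comm]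
  have hfin : α / 4 * ∑ _j : J, (Fintype.card (J → A) : ℝ) / 8 ≤
      α / 4 * ∑ j, (Fintype.card (J → A) -
        ∑ ω, ∑ y, bernWeight (θ ω) y * (if T y j = ω j then (1 : ℝ) else 0)) := by
    gcongr with j
    linarith [htest j]
  rw [Finset.sum_const, Finset.card_univ, nsmul_eq_mul] at hsum hfin
  linarith

end Assouad

/-! ### From word families to the prediction risk. -/

section Minimax

variable {d n : ℕ} {X : Matrix (Fin d) (Fin n) ℝ} {Ω : Finset (Fin n × Fin n)}

lemma norm00_sub_le (Θ Θ' : Matrix (Fin d) (Fin d) ℝ) :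
    norm00 (Θ - Θ') ≤ norm00 Θ + norm00 Θ' := by
  refine le_trans (Set.ncard_le_ncard (t := {i | Θ i ≠ 0} ∪ {i | Θ' i ≠ 0}) (fun i hi => ?_)
    (Set.toFinite _)) (Set.ncard_union_le _ _)
  by_contra h
  simp only [Set.mem_union, Set.mem_ofPred_eq, not_or, not_not] at h
  apply hi
  change Θ i - Θ' i = 0
  rw [h.1, h.2, sub_zero]

lemma affinity_sub (Θ Θ' : Matrix (Fin d) (Fin d) ℝ) :
    affinity X (Θ - Θ') = affinity X Θ - affinity X Θ' := by
  simp [affinity, Matrix.mul_sub, Matrix.sub_mul]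

lemma frobSq_nonneg (B : Matrix (Fin d) (Fin d) ℝ) : 0 ≤ frobSq B :=
  Finset.sum_nonneg fun _ _ => Finset.sum_nonneg fun _ _ => sq_nonneg _

/-- A minimax lower bound from a family of parameters indexed by words. -/
lemma le_iSup_predRisk {J A : Type*} [Fintype J] [DecidableEq J] [Fintype A] [DecidableEq A]
    {M δ a b : ℝ} {k r : ℕ} (hΩ : Ω.Nonempty) (hiso : BlockIsometry X Ω (2 * k) δ)
    (hA : 2 ≤ Fintype.card A) (ha : 0 ≤ a) (Θ : (J → A) → Matrix (Fin d) (Fin d) ℝ)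
    (hmem : ∀ ω, Θ ω ∈ paramSpace d k r M)
    (hsep : ∀ ω ω', a * (∑ j, if ω j = ω' j then 0 else 1) ≤ frobSq (Θ ω - Θ ω'))
    (hb : ∀ ω j x, frobSq (Θ (Function.update ω j x) - Θ ω) ≤ b)
    (hbL : Ω.card * b ≤ Real.log (Fintype.card A))
    (Shat : (Ω → Bool) → Matrix (Fin n) (Fin n) ℝ) :
    ENNReal.ofReal ((1 - δ) * a * Fintype.card J / 64) ≤
      ⨆ Θ ∈ paramSpace d k r M, predRisk X Ω Shat Θ := by
  have hN : (0 : ℝ) < Ω.card := by exact_mod_cast hΩ.card_pos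
  obtain ⟨hδ0, hδ1, hiso⟩ := hiso
  have hdist : ∀ ω ω', ∑ e, (logits X Ω (Θ ω) e - logits X Ω (Θ ω') e) ^ 2 =
      frobSqOn Ω (affinity X (Θ ω - Θ ω')) := fun ω ω' => by
    rw [affinity_sub, frobSqOn_affinity_sub]
  have hiso' : ∀ ω ω', _ := fun ω ω' => hiso (Θ ω - Θ ω') ((hmem ω).1.sub (hmem ω').1)
    ((norm00_sub_le _ _).trans (by have := (hmem ω).2.2.1; have := (hmem ω').2.2.1; omega))
  have : Nonempty A := Fintype.card_pos_iff.mp (by omega)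
  have hA' : (2 : ℝ) ≤ Fintype.card A := by exact_mod_cast hA
  -- Since `1 + δ ≤ 2`, one may take `β = 2Nb`; then `exp (β / 4) ≤ √L ≤ 3L / 4` because `L ≥ 2`.
  have hL : Real.exp (2 * (Ω.card * b) / 4) ≤ 3 * Fintype.card A / 4 := by
    have h1 : Real.exp (2 * (Ω.card * b) / 4) ≤ Real.exp (Real.log (Fintype.card A) / 2) :=
      Real.exp_le_exp.mpr (by linarith)
    have h2 : Real.exp (Real.log (Fintype.card A) / 2) ^ 2 = Fintype.card A := by
      rw [← Real.exp_nat_mul]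
      push_cast
      rw [mul_div_cancel₀ _ two_ne_zero, Real.exp_log (by linarith)]
    refine h1.trans (le_of_sq_le_sq ?_ (by linarith))
    rw [h2]
    nlinarith
  obtain ⟨ω, hω⟩ := exists_le_risk (α := Ω.card * (1 - δ) * a) (β := 2 * (Ω.card * b))
    (mul_nonneg (mul_nonneg hN.le (by linarith)) ha) (fun ω => logits X Ω (Θ ω))
    (fun ω ω' => by
      rw [hdist]
      refine le_trans ?_ (hiso' ω ω').1
      rw [mul_assoc]
      exact mul_le_mul_of_nonneg_left (hsep ω ω') (mul_nonneg hN.le (by linarith)))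
    (fun ω j x => by
      rw [hdist]
      refine (hiso' _ _).2.trans ?_
      have h1 := hb ω j x
      have h2 := frobSq_nonneg (Θ (Function.update ω j x) - Θ ω)
      calc _ ≤ (Ω.card : ℝ) * 2 * frobSq (Θ (Function.update ω j x) - Θ ω) := by
            gcongr; linarith
        _ ≤ (Ω.card : ℝ) * 2 * b := by gcongr
        _ = _ := by ring) hL (fun y e => Shat y e.1.1 e.1.2)
  refine le_trans ?_ (le_iSup₂ (f := fun Θ _ => predRisk X Ω Shat Θ) (Θ ω) (hmem ω))
  have hfr : ∀ y, ∑ e : Ω, (Shat y e.1.1 e.1.2 - logits X Ω (Θ ω) e) ^ 2 =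
      frobSqOn Ω (Shat y - affinity X (Θ ω)) := fun y =>
    Finset.sum_coe_sort Ω fun e => (Shat y - affinity X (Θ ω)) e.1 e.2 ^ 2
  simp_rw [hfr] at hω
  rw [predRisk, lintegral_law_ofReal X Ω _ _ fun y => frobSqOn_nonneg _,
    ← ENNReal.ofReal_natCast, ← ENNReal.ofReal_ofNat, ← ENNReal.ofReal_mul (by norm_num),
    ← ENNReal.ofReal_div_of_pos (by positivity)]
  refine ENNReal.ofReal_le_ofReal ?_
  rw [le_div_iff₀ (by positivity)]
  refine le_trans (le_of_eq ?_) hω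
  ring

end Minimax

/-! ### Binary off-diagonal blocks and the term `k r / N`. -/

section Block

variable {d a b : ℕ}

/-- The `a × b` block in rows `0, …, a - 1` and columns `a, …, a + b - 1` with entries `W`,
extended by zero. -/
def blockMatrix (d : ℕ) (W : Fin a × Fin b → ℝ) : Matrix (Fin d) (Fin d) ℝ := fun i j =>
  if h : i.1 < a ∧ a ≤ j.1 ∧ j.1 < a + b then W (⟨i, h.1⟩, ⟨j - a, by omega⟩) else 0

lemma blockMatrix_sub (W W' : Fin a × Fin b → ℝ) :
    blockMatrix d (W - W') = blockMatrix d W - blockMatrix d W' := by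
  ext i j
  simp only [blockMatrix, Matrix.sub_apply]
  split_ifs <;> simp

lemma blockMatrix_ne_zero {W : Fin a × Fin b → ℝ} {i j : Fin d} (h : blockMatrix d W i j ≠ 0) :
    i.1 < a ∧ a ≤ j.1 ∧ j.1 < a + b := by
  by_contra hc
  exact h (by simp [blockMatrix, hc])

lemma sum_blockMatrix (hd : a + b ≤ d) (W : Fin a × Fin b → ℝ) {g : ℝ → ℝ} (hg : g 0 = 0) :
    ∑ i, ∑ j, g (blockMatrix d W i j) = ∑ p, g (W p) := by
  rw [← Fintype.sum_prod_type' fun i j => g (blockMatrix d W i j)]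
  let φ : Fin a × Fin b → Fin d × Fin d := fun p =>
    (⟨p.1, by omega⟩, ⟨a + p.2, by omega⟩)
  have hφ : Function.Injective φ := by
    rintro ⟨i, j⟩ ⟨i', j'⟩ h
    simp only [φ, Prod.mk.injEq, Fin.mk.injEq] at h
    ext <;> simp only <;> omega
  symm
  refine Fintype.sum_of_injective φ hφ _ _ (fun x hx => ?_) fun p => ?_
  · have : blockMatrix d W x.1 x.2 = 0 := by
      by_contra hne
      obtain ⟨h1, h2, h3⟩ := blockMatrix_ne_zero hne
      refine hx ⟨(⟨x.1, h1⟩, ⟨x.2 - a, by omega⟩), ?_⟩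
      ext
      · rfl
      · simp only [φ]; omega
    rw [this, hg]
  · have h : p.1.1 < a ∧ a ≤ a + p.2.1 ∧ a + p.2.1 < a + b := ⟨p.1.2, by omega, by omega⟩
    simp [φ, blockMatrix]

/-- The symmetric matrix with off-diagonal blocks `W` and `Wᵀ`. -/
def symmBlock (d : ℕ) (W : Fin a × Fin b → ℝ) : Matrix (Fin d) (Fin d) ℝ :=
  blockMatrix d W + (blockMatrix d W).transpose

lemma symmBlock_sub (W W' : Fin a × Fin b → ℝ) :
    symmBlock d W - symmBlock d W' = symmBlock d (W - W') := by
  simp only [symmBlock, blockMatrix_sub, Matrix.transpose_sub]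
  abel

/-- The block and its transpose occupy disjoint positions, so the cross terms vanish and the entries
of `W` are free of symmetry constraints. -/
lemma frobSq_symmBlock (hd : a + b ≤ d) (W : Fin a × Fin b → ℝ) :
    frobSq (symmBlock d W) = 2 * ∑ p, W p ^ 2 := by
  rw [← sum_blockMatrix hd W (g := fun x => x ^ 2) (by simp), two_mul]
  conv_rhs =>
    enter [2]
    rw [Finset.sum_comm]
  simp only [frobSq, ← Finset.sum_add_distrib]
  refine Finset.sum_congr rfl fun i _ => Finset.sum_congr rfl fun j _ => ?_
  have h : blockMatrix d W i j * blockMatrix d W j i = 0 := by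
    by_contra hne
    have h1 := blockMatrix_ne_zero (left_ne_zero_of_mul hne)
    have h2 := blockMatrix_ne_zero (right_ne_zero_of_mul hne)
    omega
  simp only [symmBlock, Matrix.add_apply, Matrix.transpose_apply]
  linarith

lemma norm11_symmBlock_le (hd : a + b ≤ d) (W : Fin a × Fin b → ℝ) :
    norm11 (symmBlock d W) ≤ 2 * ∑ p, |W p| := by
  rw [← sum_blockMatrix hd W (g := fun x => |x|) (by simp), two_mul]
  conv_rhs =>
    enter [2]
    rw [Finset.sum_comm]
  simp only [norm11, ← Finset.sum_add_distrib]
  exact Finset.sum_le_sum fun i _ => Finset.sum_le_sum fun j _ => abs_add_le _ _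

lemma norm00_le_of_forall {k : ℕ} {Θ : Matrix (Fin d) (Fin d) ℝ}
    (h : ∀ i j, Θ i j ≠ 0 → i.1 < k) : norm00 Θ ≤ k := by
  rw [← card_rowSupport, ← Finset.card_range k]
  refine Finset.card_le_card_of_injOn (fun i => i.1) (fun i hi => ?_) Fin.val_injective.injOn
  have hi' : Θ i ≠ 0 := by simpa [rowSupport] using hi
  obtain ⟨j, hj⟩ := Function.ne_iff.mp hi'
  simpa using h i j hj

lemma rank_add_le_add (B C : Matrix (Fin d) (Fin d) ℝ) : (B + C).rank ≤ B.rank + C.rank := by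
  have h : LinearMap.range (B + C).mulVecLin ≤
      LinearMap.range B.mulVecLin ⊔ LinearMap.range C.mulVecLin := by
    rw [Matrix.mulVecLin_add]
    exact LinearMap.range_add_le _ _
  exact (Submodule.finrank_mono h).trans (Submodule.finrank_add_le_finrank_add_finrank _ _)

lemma rank_symmBlock_le (W : Fin a × Fin b → ℝ) : (symmBlock d W).rank ≤ 2 * a := by
  have h1 : (blockMatrix d W).rank ≤ a :=
    (rank_le_norm00 _).trans (norm00_le_of_forall fun i j h => (blockMatrix_ne_zero h).1)
  refine (rank_add_le_add _ _).trans ?_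
  rw [Matrix.rank_transpose]
  omega

lemma symmBlock_mem (hd : a + b ≤ d) {r : ℕ} {M : ℝ} (hr : 2 * a ≤ r) {W : Fin a × Fin b → ℝ}
    (hW : 2 * ∑ p, |W p| < M) : symmBlock d W ∈ paramSpace d (a + b) r M := by
  refine ⟨?_, (norm11_symmBlock_le hd W).trans_lt hW, norm00_le_of_forall fun i j h => ?_,
    (rank_symmBlock_le W).trans hr⟩
  · rw [Matrix.IsSymm, symmBlock, Matrix.transpose_add, Matrix.transpose_transpose, add_comm]
  · by_contra hlt
    refine h ?_
    have h1 : blockMatrix d W i j = 0 := by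
      by_contra hne
      have := blockMatrix_ne_zero hne
      omega
    have h2 : blockMatrix d W j i = 0 := by
      by_contra hne
      have := blockMatrix_ne_zero hne
      omega
    simp [symmBlock, h1, h2]

lemma le_iSup_predRisk_block {n : ℕ} {X : Matrix (Fin d) (Fin n) ℝ} {Ω : Finset (Fin n × Fin n)}
    {M δ : ℝ} {k r : ℕ} (hM : 0 < M) (hΩ : Ω.Nonempty) (hkd : k ≤ d) (hr : 2 ≤ r) (hrk : r ≤ k)
    (hiso : BlockIsometry X Ω (2 * k) δ) (hN : (k : ℝ) ^ 2 * (k * r / Ω.card) ≤ M ^ 2)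
    (Shat : (Ω → Bool) → Matrix (Fin n) (Fin n) ℝ) :
    ENNReal.ofReal ((1 - δ) * (k * r / Ω.card) / 768) ≤
      ⨆ Θ ∈ paramSpace d k r M, predRisk X Ω Shat Θ := by
  have hcard : (0 : ℝ) < Ω.card := by exact_mod_cast hΩ.card_pos
  have hδ := hiso.2.1
  -- Height `⌊r/2⌋` keeps the rank at most `r` and, as `2 ≤ r ≤ k`, leaves at least `k r / 6` free
  -- entries.
  obtain ⟨a, b, hab, hra, hra3, hbk⟩ : ∃ a b, a + b = k ∧ 2 * a ≤ r ∧ r ≤ 3 * a ∧ k ≤ 2 * b :=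
    ⟨r / 2, k - r / 2, by omega, by omega, by omega, by omega⟩
  subst hab
  -- One flipped bit costs `N * 2τ² = 1/2 < log 2`.
  set τ : ℝ := √(1 / (4 * Ω.card)) with hτdef
  have hτ : τ ^ 2 = 1 / (4 * Ω.card) := Real.sq_sqrt (by positivity)
  have hτ0 : 0 < τ := Real.sqrt_pos.mpr (by positivity)
  have hab6 : ((a + b : ℕ) : ℝ) * r ≤ 6 * (a * b) := by
    have : (a + b) * r ≤ (2 * b) * (3 * a) := Nat.mul_le_mul hbk hra3
    calc ((a + b : ℕ) : ℝ) * r ≤ ((2 * b) * (3 * a) : ℕ) := by exact_mod_cast this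
      _ = _ := by push_cast; ring
  let W : (Fin a × Fin b → Bool) → Fin a × Fin b → ℝ := fun ω p => if ω p then τ else 0
  have hWle : ∀ ω p, |W ω p| ≤ τ := fun ω p => by
    simp only [W]
    split_ifs
    · rw [abs_of_pos hτ0]
    · simpa using hτ0.le
  have hdiff : ∀ ω ω', frobSq (symmBlock d (W ω) - symmBlock d (W ω')) =
      2 * τ ^ 2 * ∑ p, if ω p = ω' p then 0 else 1 := fun ω ω' => by
    rw [symmBlock_sub, frobSq_symmBlock hkd, mul_assoc, Finset.mul_sum (a := τ ^ 2)]
    congr 1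
    refine Finset.sum_congr rfl fun p _ => ?_
    simp only [W, Pi.sub_apply]
    cases ω p <;> cases ω' p <;> simp
  have hnorm : ∀ ω, 2 * ∑ p, |W ω p| < M := fun ω => by
    have h1 : ∑ p, |W ω p| ≤ a * b * τ := by
      calc _ ≤ ∑ _p : Fin a × Fin b, τ := Finset.sum_le_sum fun p _ => hWle ω p
        _ = _ := by simp
    refine lt_of_le_of_lt (mul_le_mul_of_nonneg_left h1 zero_le_two) ?_
    refine lt_of_pow_lt_pow_left₀ 2 hM.le ?_
    have h2 : (2 * (a : ℝ) * b) ^ 2 ≤ ((a + b : ℕ) : ℝ) ^ 2 * ((a + b : ℕ) * r) := by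
      have h3 : (2 * a * b) ^ 2 ≤ (a + b) ^ 2 * ((a + b) * r) := by
        calc (2 * a * b) ^ 2 = (2 * a * b) * (2 * a * b) := by ring
          _ ≤ (r * (a + b)) * ((a + b) * (a + b)) := by gcongr <;> omega
          _ = _ := by ring
      exact_mod_cast h3
    calc (2 * (a * b * τ)) ^ 2 = (2 * (a : ℝ) * b) ^ 2 / Ω.card / 4 := by
          rw [show 2 * (a * b * τ) = (2 * a * b) * τ by ring, mul_pow _ τ, hτ]
          field_simp
      _ ≤ ((a + b : ℕ) : ℝ) ^ 2 * ((a + b : ℕ) * r) / Ω.card / 4 := by gcongr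
      _ = ((a + b : ℕ) : ℝ) ^ 2 * ((a + b : ℕ) * r / Ω.card) / 4 := by ring
      _ ≤ M ^ 2 / 4 := by gcongr
      _ < M ^ 2 := by have : 0 < M ^ 2 := by positivity
                      linarith
  refine le_trans (ENNReal.ofReal_le_ofReal ?_) (le_iSup_predRisk (a := 2 * τ ^ 2)
    (b := 2 * τ ^ 2) hΩ hiso (by simp) (by positivity) (fun ω => symmBlock d (W ω))
    (fun ω => symmBlock_mem hkd hra (hnorm ω)) (fun ω ω' => (hdiff ω ω').ge)
    (fun ω j x => ?_) ?_ Shat)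
  · rw [Fintype.card_prod, Fintype.card_fin, Fintype.card_fin, hτ]
    have : (1 - δ) * (((a + b : ℕ) : ℝ) * r) ≤ (1 - δ) * (6 * (a * b)) :=
      mul_le_mul_of_nonneg_left hab6 (by linarith)
    push_cast at this ⊢
    rw [show (1 - δ) * (((a : ℝ) + b) * r / Ω.card) / 768 =
      (1 - δ) * (((a : ℝ) + b) * r) / (768 * Ω.card) by field_simp,
      show (1 - δ) * (2 * (1 / (4 * (Ω.card : ℝ)))) * (a * b) / 64 =
      (1 - δ) * (6 * (a * b)) / (768 * Ω.card) by field_simp; ring]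
    gcongr
  · rw [hdiff]
    refine mul_le_of_le_one_right (by positivity) ?_
    rw [Finset.sum_eq_single j (fun p _ hp => by simp [hp]) (by simp)]
    split_ifs <;> norm_num
  · rw [hτ, Fintype.card_bool]
    have := Real.log_two_gt_d9
    rw [show (Ω.card : ℝ) * (2 * (1 / (4 * Ω.card))) = 1 / 2 by field_simp; norm_num]
    push_cast
    linarith

end Block

/-! ### Sparse rank-one matrices and the logarithmic term. -/

section RankOne

variable {d k m : ℕ}

/-- The symmetric rank-one matrix `τ v vᵀ`. -/
def rankOne (τ : ℝ) (v : Fin d → ℝ) : Matrix (Fin d) (Fin d) ℝ := Matrix.vecMulVec (τ • v) v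

lemma rankOne_apply (τ : ℝ) (v : Fin d → ℝ) (i j : Fin d) : rankOne τ v i j = τ * (v i * v j) := by
  simp [rankOne, Matrix.vecMulVec_apply, mul_assoc]

lemma frobSq_rankOne_sub (τ : ℝ) (v w : Fin d → ℝ) :
    frobSq (rankOne τ v - rankOne τ w) =
      τ ^ 2 * ((v ⬝ᵥ v) ^ 2 + (w ⬝ᵥ w) ^ 2 - 2 * (v ⬝ᵥ w) ^ 2) := by
  have hsq : ∀ x y : Fin d → ℝ, (x ⬝ᵥ y) ^ 2 = ∑ i, ∑ j, x i * y i * (x j * y j) := fun x y => by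
    rw [sq, dotProduct, Fintype.sum_mul_sum]
  simp only [hsq, frobSq, Matrix.sub_apply, rankOne_apply, Finset.mul_sum,
    ← Finset.sum_add_distrib, ← Finset.sum_sub_distrib]
  exact Finset.sum_congr rfl fun i _ => Finset.sum_congr rfl fun j _ => by ring

lemma norm11_rankOne {τ : ℝ} (hτ : 0 ≤ τ) (v : Fin d → ℝ) :
    norm11 (rankOne τ v) = τ * (∑ i, |v i|) ^ 2 := by
  rw [sq, Fintype.sum_mul_sum]
  simp only [norm11, rankOne_apply, Finset.mul_sum, abs_mul, abs_of_nonneg hτ]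

/-- The magnitude encoded by a bit. -/
def amplitude (b : Bool) : ℝ := if b then 2 else 1

lemma amplitude_mem (b : Bool) : 1 ≤ amplitude b ∧ amplitude b ≤ 2 := by
  cases b <;> norm_num [amplitude]

/-- The inner product of the vectors encoded by two letters. -/
def letterInner (x y : Fin m × Bool) : ℝ :=
  if x.1 = y.1 then amplitude x.2 * amplitude y.2 else 0

lemma letterInner_nonneg (x y : Fin m × Bool) : 0 ≤ letterInner x y := by
  have := amplitude_mem x.2
  have := amplitude_mem y.2
  unfold letterInner
  split_ifs
  · nlinarith
  · exact le_rfl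

lemma letterInner_self (x : Fin m × Bool) : 1 ≤ letterInner x x ∧ letterInner x x ≤ 4 := by
  have := amplitude_mem x.2
  simp only [letterInner, if_true]
  constructor <;> nlinarith

/-- This is the squared distance of the encoded vectors. The two amplitudes keep at least two
letters when groups have a single coordinate; their positivity removes the sign ambiguity of `v vᵀ`.
-/
lemma one_le_letterInner_of_ne {x y : Fin m × Bool} (h : x ≠ y) :
    1 ≤ letterInner x x + letterInner y y - 2 * letterInner x y := by
  obtain ⟨i, b⟩ := x
  obtain ⟨j, c⟩ := y
  by_cases hij : i = j
  · subst hij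
    cases b <;> cases c <;> simp_all [letterInner, amplitude]
  · have h1 := (letterInner_self (i, b)).1
    have h2 := (letterInner_self (j, c)).1
    have h3 : letterInner (i, b) (j, c) = 0 := by simp [letterInner, hij]
    rw [h3]
    linarith

/-- The position of the `l`-th coordinate of the `j`-th group. -/
def position (hd : k * m ≤ d) (p : Fin k × Fin m) : Fin d := Fin.castLE hd (finProdFinEquiv p)

lemma position_injective (hd : k * m ≤ d) : Function.Injective (position hd) :=
  (Fin.castLE_injective hd).comp finProdFinEquiv.injective

/-- The vector with one nonzero entry in each of `k` groups of `m` coordinates, encoding the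
word `ω`. -/
def wordVec (hd : k * m ≤ d) (ω : Fin k → Fin m × Bool) : Fin d → ℝ :=
  Function.extend (position hd)
    (fun p => if (ω p.1).1 = p.2 then amplitude (ω p.1).2 else 0) 0

lemma wordVec_position (hd : k * m ≤ d) (ω : Fin k → Fin m × Bool) (p : Fin k × Fin m) :
    wordVec hd ω (position hd p) = if (ω p.1).1 = p.2 then amplitude (ω p.1).2 else 0 :=
  (position_injective hd).extend_apply _ _ _

lemma wordVec_of_notMem (hd : k * m ≤ d) (ω : Fin k → Fin m × Bool) {i : Fin d}
    (hi : i ∉ Set.range (position hd)) : wordVec hd ω i = 0 :=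
  Function.extend_apply' _ _ _ hi

lemma wordVec_dotProduct (hd : k * m ≤ d) (ω ω' : Fin k → Fin m × Bool) :
    wordVec hd ω ⬝ᵥ wordVec hd ω' = ∑ j, letterInner (ω j) (ω' j) := by
  rw [dotProduct, ← Fintype.sum_of_injective (position hd) (position_injective hd)
    (fun p => wordVec hd ω (position hd p) * wordVec hd ω' (position hd p)) _
    (fun i hi => by rw [wordVec_of_notMem hd ω hi, zero_mul]) fun p => rfl, Fintype.sum_prod_type]
  refine Finset.sum_congr rfl fun j _ => ?_
  simp only [wordVec_position, ite_mul, zero_mul, Finset.sum_ite_eq, Finset.mem_univ, if_true]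
  by_cases h : (ω j).1 = (ω' j).1
  · simp [letterInner, h]
  · simp [letterInner, h, Ne.symm h]

lemma sum_abs_wordVec_le (hd : k * m ≤ d) (ω : Fin k → Fin m × Bool) :
    ∑ i, |wordVec hd ω i| ≤ 2 * k := by
  rw [← Fintype.sum_of_injective (position hd) (position_injective hd)
    (fun p => |wordVec hd ω (position hd p)|) _
    (fun i hi => by rw [wordVec_of_notMem hd ω hi, abs_zero]) fun p => rfl, Fintype.sum_prod_type]
  calc _ ≤ ∑ _j : Fin k, (2 : ℝ) := by
        refine Finset.sum_le_sum fun j _ => ?_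
        have := amplitude_mem (ω j).2
        simp only [wordVec_position, apply_ite abs, abs_zero, Finset.sum_ite_eq, Finset.mem_univ,
          if_true]
        rw [abs_of_nonneg (by linarith)]
        exact this.2
    _ = _ := by simp [mul_comm]

lemma norm00_rankOne_wordVec_le (hd : k * m ≤ d) (τ : ℝ) (ω : Fin k → Fin m × Bool) :
    norm00 (rankOne τ (wordVec hd ω)) ≤ k := by
  classical
  rw [← card_rowSupport]
  refine le_trans (Finset.card_le_card
    (t := Finset.univ.image fun j : Fin k => position hd (j, (ω j).1)) fun i hi => ?_)
    (Finset.card_image_le.trans (by simp))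
  have hi' : rankOne τ (wordVec hd ω) i ≠ 0 := by simpa [rowSupport] using hi
  obtain ⟨j, hj⟩ := Function.ne_iff.mp hi'
  rw [rankOne_apply] at hj
  have hv : wordVec hd ω i ≠ 0 := left_ne_zero_of_mul (right_ne_zero_of_mul hj)
  have hrange : i ∈ Set.range (position hd) := by
    by_contra hn
    exact hv (wordVec_of_notMem hd ω hn)
  obtain ⟨⟨j, l⟩, rfl⟩ := hrange
  rw [wordVec_position] at hv
  have : (ω j).1 = l := by
    by_contra hn
    exact hv (if_neg hn)
  subst this
  exact Finset.mem_image_of_mem _ (Finset.mem_univ j)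

lemma rankOne_wordVec_mem (hd : k * m ≤ d) {τ M : ℝ} (hτ : 0 ≤ τ) (hM : τ * (2 * k) ^ 2 < M)
    {r : ℕ} (hr : 1 ≤ r) (ω : Fin k → Fin m × Bool) :
    rankOne τ (wordVec hd ω) ∈ paramSpace d k r M := by
  refine ⟨?_, ?_, norm00_rankOne_wordVec_le hd τ ω, (Matrix.rank_vecMulVec_le _ _).trans hr⟩
  · ext i j
    rw [Matrix.transpose_apply, rankOne_apply, rankOne_apply, mul_comm (wordVec hd ω j)]
  · rw [norm11_rankOne hτ]
    refine lt_of_le_of_lt (mul_le_mul_of_nonneg_left (pow_le_pow_left₀ ?_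
      (sum_abs_wordVec_le hd ω) 2) hτ) hM
    exact Finset.sum_nonneg fun _ _ => abs_nonneg _

/-- With squared norms `p, q ≥ k` and inner product `s ≥ 0`, one has `p² + q² - 2s² ≥ (p + q + 2s)(p
+ q - 2s) / 2`. The first factor is at least `2k`, the second at least the Hamming distance. -/
lemma le_frobSq_wordVec (hd : k * m ≤ d) (τ : ℝ) (ω ω' : Fin k → Fin m × Bool) :
    τ ^ 2 * k * (∑ j, if ω j = ω' j then 0 else 1) ≤
      frobSq (rankOne τ (wordVec hd ω) - rankOne τ (wordVec hd ω')) := by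
  rw [frobSq_rankOne_sub, wordVec_dotProduct, wordVec_dotProduct, wordVec_dotProduct, mul_assoc]
  refine mul_le_mul_of_nonneg_left ?_ (sq_nonneg τ)
  have hself : ∀ w : Fin k → Fin m × Bool, (k : ℝ) ≤ ∑ j, letterInner (w j) (w j) := fun w => by
    calc (k : ℝ) = ∑ _j : Fin k, (1 : ℝ) := by simp
      _ ≤ _ := Finset.sum_le_sum fun j _ => (letterInner_self (w j)).1
  have hdist : (∑ j, if ω j = ω' j then (0 : ℝ) else 1) ≤ ∑ j, letterInner (ω j) (ω j) +
      ∑ j, letterInner (ω' j) (ω' j) - 2 * ∑ j, letterInner (ω j) (ω' j) := by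
    rw [Finset.mul_sum, ← Finset.sum_add_distrib, ← Finset.sum_sub_distrib]
    refine Finset.sum_le_sum fun j _ => ?_
    split_ifs with h
    · rw [h]; linarith
    · exact one_le_letterInner_of_ne h
  have h0 : 0 ≤ ∑ j, if ω j = ω' j then (0 : ℝ) else 1 :=
    Finset.sum_nonneg fun j _ => by split_ifs <;> norm_num
  have hs : 0 ≤ ∑ j, letterInner (ω j) (ω' j) :=
    Finset.sum_nonneg fun j _ => letterInner_nonneg _ _
  have hp := hself ω
  have hq := hself ω'
  generalize (∑ j, if ω j = ω' j then (0 : ℝ) else 1) = h at *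
  generalize ∑ j, letterInner (ω j) (ω j) = p at *
  generalize ∑ j, letterInner (ω' j) (ω' j) = q at *
  generalize ∑ j, letterInner (ω j) (ω' j) = s at *
  calc (k : ℝ) * h ≤ ((p + q + 2 * s) / 2) * (p + q - 2 * s) := by
        gcongr
        · linarith [h0.trans hdist]
        · linarith
    _ ≤ p ^ 2 + q ^ 2 - 2 * s ^ 2 := by nlinarith [sq_nonneg (p - q)]

/-- In `(p - s)(p + s) + (q - s)(q + s)` only the changed letter contributes to the differences, so
these are at most `4`, while the sums are at most `8k`. -/
lemma frobSq_wordVec_update_le (hd : k * m ≤ d) (τ : ℝ) (ω : Fin k → Fin m × Bool) (j : Fin k)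
    (x : Fin m × Bool) :
    frobSq (rankOne τ (wordVec hd (Function.update ω j x)) - rankOne τ (wordVec hd ω)) ≤
      64 * k * τ ^ 2 := by
  set ω' := Function.update ω j x
  rw [frobSq_rankOne_sub, wordVec_dotProduct, wordVec_dotProduct, wordVec_dotProduct,
    mul_comm (64 * (k : ℝ))]
  refine mul_le_mul_of_nonneg_left ?_ (sq_nonneg τ)
  have hself : ∀ w : Fin k → Fin m × Bool, ∑ j, letterInner (w j) (w j) ≤ 4 * k := fun w => by
    calc _ ≤ ∑ _j : Fin k, (4 : ℝ) := Finset.sum_le_sum fun j _ => (letterInner_self (w j)).2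
      _ = 4 * k := by simp [mul_comm]
  have hne : ∀ i, i ≠ j → ω' i = ω i := fun i hi => Function.update_of_ne hi _ _
  have hone : ∀ w : Fin k → Fin m × Bool, (∀ i, i ≠ j → ω' i = w i ∧ ω i = w i) →
      ∑ i, letterInner (w i) (w i) - ∑ i, letterInner (ω' i) (ω i) ≤ 4 := fun w hw => by
    rw [← Finset.sum_sub_distrib, Finset.sum_eq_single j
      (fun i _ hi => by rw [(hw i hi).1, (hw i hi).2, sub_self]) (by simp)]
    linarith [(letterInner_self (w j)).2, letterInner_nonneg (ω' j) (ω j)]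
  have h1 := hone ω' fun i hi => ⟨rfl, (hne i hi).symm⟩
  have h2 := hone ω fun i hi => ⟨hne i hi, rfl⟩
  have hs : 0 ≤ ∑ i, letterInner (ω' i) (ω i) :=
    Finset.sum_nonneg fun j _ => letterInner_nonneg _ _
  have hp0 : 0 ≤ ∑ i, letterInner (ω' i) (ω' i) :=
    Finset.sum_nonneg fun j _ => letterInner_nonneg _ _
  have hq0 : 0 ≤ ∑ i, letterInner (ω i) (ω i) :=
    Finset.sum_nonneg fun j _ => letterInner_nonneg _ _
  have hs' : ∑ i, letterInner (ω' i) (ω i) ≤ 4 * k := by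
    calc _ ≤ ∑ _j : Fin k, (4 : ℝ) := by
          refine Finset.sum_le_sum fun i _ => ?_
          have a1 := amplitude_mem (ω' i).2
          have a2 := amplitude_mem (ω i).2
          unfold letterInner
          split_ifs
          · nlinarith
          · norm_num
      _ = 4 * k := by simp [mul_comm]
  have hp := hself ω'
  have hq := hself ω
  generalize ∑ i, letterInner (ω' i) (ω' i) = p at *
  generalize ∑ i, letterInner (ω i) (ω i) = q at *
  generalize ∑ i, letterInner (ω' i) (ω i) = s at *
  have e1 : (p - s) * (p + s) ≤ 4 * (8 * k) :=
    (mul_le_mul_of_nonneg_right h1 (by linarith)).trans (by linarith)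
  have e2 : (q - s) * (q + s) ≤ 4 * (8 * k) :=
    (mul_le_mul_of_nonneg_right h2 (by linarith)).trans (by linarith)
  nlinarith

lemma le_iSup_predRisk_rankOne {n : ℕ} {X : Matrix (Fin d) (Fin n) ℝ}
    {Ω : Finset (Fin n × Fin n)} {M δ : ℝ} {r : ℕ} (hM : 0 < M) (hΩ : Ω.Nonempty) (hk : 1 ≤ k)
    (hkd : k ≤ d) (hr : 1 ≤ r) (hiso : BlockIsometry X Ω (2 * k) δ)
    (hN : (k : ℝ) ^ 2 * (k / Ω.card * Real.log (d * Real.exp 1 / k)) ≤ M ^ 2)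
    (Shat : (Ω → Bool) → Matrix (Fin n) (Fin n) ℝ) :
    ENNReal.ofReal ((1 - δ) * (k / Ω.card * Real.log (d * Real.exp 1 / k)) / 10240) ≤
      ⨆ Θ ∈ paramSpace d k r M, predRisk X Ω Shat Θ := by
  have hcard : (0 : ℝ) < Ω.card := by exact_mod_cast hΩ.card_pos
  have hk0 : (0 : ℝ) < k := by exact_mod_cast hk
  have hd0 : (0 : ℝ) < d := by exact_mod_cast hk.trans hkd
  have hδ := hiso.2.1
  -- Groups of `⌊d/k⌋` coordinates; rounding loses at most a factor `2`.
  obtain ⟨m, hm, hmd, hdm⟩ : ∃ m, 1 ≤ m ∧ k * m ≤ d ∧ d ≤ 2 * (k * m) := by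
    refine ⟨d / k, (Nat.one_le_div_iff hk).mpr hkd, Nat.mul_div_le d k, ?_⟩
    have h1 := Nat.lt_mul_div_succ d hk
    have h2 : 1 ≤ d / k := (Nat.one_le_div_iff hk).mpr hkd
    nlinarith
  have hA : Fintype.card (Fin m × Bool) = m * 2 := by simp
  set L : ℝ := (Fintype.card (Fin m × Bool) : ℝ) with hL
  have hLm : L = m * 2 := by rw [hL, hA]; push_cast; ring
  have hL2 : 2 ≤ L := by
    have : (1 : ℝ) ≤ m := by exact_mod_cast hm
    linarith
  have hlog2 : Real.log 2 ≤ Real.log L := Real.log_le_log (by norm_num) hL2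
  have hlogL : 0 < Real.log L := Real.log_pos (by linarith)
  have hLle : Real.log L ≤ Real.log (d * Real.exp 1 / k) := by
    refine Real.log_le_log (by linarith) ?_
    rw [le_div_iff₀ hk0, hLm]
    have h1 : (k : ℝ) * m ≤ d := by exact_mod_cast hmd
    have h2 : 2 ≤ Real.exp 1 := by linarith [Real.exp_one_gt_d9]
    nlinarith
  -- Since `d / k ≤ L`, the left side is at most `log L + 1`, and `log L ≥ log 2 > 2/3`.
  have hleL : Real.log (d * Real.exp 1 / k) ≤ 5 / 2 * Real.log L := by
    have h1 : (d : ℝ) * Real.exp 1 / k ≤ L * Real.exp 1 := by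
      rw [div_le_iff₀ hk0, hLm]
      have h2 : (d : ℝ) ≤ 2 * (k * m) := by exact_mod_cast hdm
      nlinarith [Real.exp_pos 1]
    have h2 := Real.log_le_log (by positivity) h1
    rw [Real.log_mul (by linarith) (Real.exp_pos 1).ne', Real.log_exp] at h2
    have := Real.log_two_gt_d9
    linarith
  -- Calibrated so that changing one letter costs exactly `N * 64kτ² = log L`.
  set τ : ℝ := √(Real.log L / (64 * k * Ω.card)) with hτdef
  have hτ : τ ^ 2 = Real.log L / (64 * k * Ω.card) := Real.sq_sqrt (by positivity)
  have hτ0 : 0 ≤ τ := Real.sqrt_nonneg _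
  have hnorm : τ * (2 * k) ^ 2 < M := by
    refine lt_of_pow_lt_pow_left₀ 2 hM.le ?_
    calc (τ * (2 * k) ^ 2) ^ 2 = (k : ℝ) ^ 2 * (k / Ω.card * Real.log L) / 4 := by
          rw [mul_pow, hτ]
          field_simp
          ring
      _ ≤ (k : ℝ) ^ 2 * (k / Ω.card * Real.log (d * Real.exp 1 / k)) / 4 := by gcongr
      _ ≤ M ^ 2 / 4 := by gcongr
      _ < M ^ 2 := by
        have : 0 < M ^ 2 := by positivity
        linarith
  refine le_trans (ENNReal.ofReal_le_ofReal ?_) (le_iSup_predRisk (a := τ ^ 2 * k)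
    (b := 64 * k * τ ^ 2) hΩ hiso (by omega) (by positivity)
    (fun ω : Fin k → Fin m × Bool => rankOne τ (wordVec hmd ω))
    (fun ω => rankOne_wordVec_mem hmd hτ0 hnorm hr ω)
    (fun ω ω' => le_frobSq_wordVec hmd τ ω ω')
    (fun ω j x => frobSq_wordVec_update_le hmd τ ω j x) (le_of_eq ?_) Shat)
  · rw [Fintype.card_fin, hτ, show (1 - δ) * (Real.log L / (64 * k * Ω.card) * k) * (k : ℝ) / 64 =
      (1 - δ) * (k / Ω.card * (5 / 2 * Real.log L)) / 10240 by field_simp; ring]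
    have : 0 ≤ 1 - δ := by linarith
    gcongr
  · rw [hτ, ← hL]
    field_simp

end RankOne

/-! ### Combining the two constructions. -/

section Lower

lemma le_iInf_iSup_predRisk {d n : ℕ} {X : Matrix (Fin d) (Fin n) ℝ}
    {Ω : Finset (Fin n × Fin n)} {M δ : ℝ} {k r : ℕ} (hM : 0 < M) (hΩ : Ω.Nonempty) (hk : 1 ≤ k)
    (hkd : k ≤ d) (hr : 1 ≤ r) (hrk : r ≤ k) (hiso : BlockIsometry X Ω (2 * k) δ)
    (hN : (k : ℝ) ^ 2 * rate Ω.card d k r ≤ M ^ 2) :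
    ENNReal.ofReal (1 / 20480 * ((1 - δ) / (1 + δ)) * rate Ω.card d k r) ≤
      ⨅ Shat : (Ω → Bool) → Matrix (Fin n) (Fin n) ℝ,
        ⨆ Θ ∈ paramSpace d k r M, predRisk X Ω Shat Θ := by
  refine le_iInf fun Shat => ?_
  have hcard : (0 : ℝ) < Ω.card := by exact_mod_cast hΩ.card_pos
  have hδ0 := hiso.1
  have hδ1 := hiso.2.1
  rw [rate] at hN ⊢
  have hlog := le_mul_log hkd
  have hk1 : (1 : ℝ) ≤ k := by exact_mod_cast hk
  have hA0 : 0 ≤ (k : ℝ) * r / Ω.card := by positivity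
  have hB1 : (k : ℝ) / Ω.card ≤ k / Ω.card * Real.log (d * Real.exp 1 / k) := by
    rw [div_mul_eq_mul_div]
    gcongr
  have hB0 : 0 ≤ (k : ℝ) / Ω.card * Real.log (d * Real.exp 1 / k) := le_trans (by positivity) hB1
  have hδ : (1 - δ) / (1 + δ) ≤ 1 - δ := div_le_self (by linarith) (by linarith)
  have hr1 : r = 1 → (k : ℝ) * r / Ω.card ≤ k / Ω.card * Real.log (d * Real.exp 1 / k) := by
    rintro rfl
    simpa using hB1
  have hb := fun h => le_iSup_predRisk_block (X := X) (δ := δ) hM hΩ hkd h hrk hiso (le_trans (by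
    gcongr; linarith) hN) Shat
  have ho := le_iSup_predRisk_rankOne (X := X) (δ := δ) hM hΩ hk hkd hr hiso (le_trans (by
    gcongr; linarith) hN) Shat
  generalize (k : ℝ) * r / Ω.card = a at *
  generalize (k : ℝ) / Ω.card * Real.log (d * Real.exp 1 / k) = b at *
  have hle : 1 / 20480 * ((1 - δ) / (1 + δ)) * (a + b) ≤ 1 / 20480 * (1 - δ) * (a + b) := by
    gcongr
  -- The dominant term is at least half of the rate, whence `20480 = 2 * 10240`. The block family
  -- needs `r ≥ 2`; for `r = 1` the logarithmic term dominates.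
  rcases le_or_gt a b with hab | hab
  · refine le_trans (ENNReal.ofReal_le_ofReal (hle.trans ?_)) ho
    nlinarith
  · have h2 : 2 ≤ r := by
      by_contra hlt
      exact absurd (hr1 (by omega)) (not_le.mpr hab)
    refine le_trans (ENNReal.ofReal_le_ofReal (hle.trans ?_)) (hb h2)
    nlinarith

end Lower

end

end MatrixLogistic

theorem mainTheorem5 :
    ∃ c₁ C₂ : ℝ, 1 < c₁ ∧ 0 < C₂ ∧
      -- upper bound: the constant `C₁` depends only on the penalty constant `c`
      (∀ c : ℝ, 0 < c → ∃ C₁ : ℝ, 3 * c < C₁ ∧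
        ∀ M : ℝ, 0 < M → c₁ / MatrixLogistic.curv M ≤ c →
        ∀ (n d : ℕ) (X : Matrix (Fin d) (Fin n) ℝ) (Ω : Finset (Fin n × Fin n)),
          (∀ e ∈ Ω, e.1 < e.2) → Ω.Nonempty → MatrixLogistic.BoundedDesign X Ω M →
        ∀ k r : ℕ, 1 ≤ k → k ≤ d → 1 ≤ r → r ≤ k →
        ∀ Θhat : (Ω → Bool) → Matrix (Fin d) (Fin d) ℝ,
          MatrixLogistic.IsPenalizedMLE c M X Ω Θhat →
          (⨆ Θ ∈ MatrixLogistic.paramSpace d k r M, MatrixLogistic.klRisk X Ω Θhat Θ) ≤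
              ENNReal.ofReal (C₁ * MatrixLogistic.rate Ω.card d k r) ∧
          (⨆ Θ ∈ MatrixLogistic.paramSpace d k r M,
              MatrixLogistic.predRisk X Ω (fun y => MatrixLogistic.affinity X (Θhat y)) Θ) ≤
            ENNReal.ofReal
              (C₁ / MatrixLogistic.curv M * MatrixLogistic.rate Ω.card d k r)) ∧
      -- minimax lower bound over all estimators of the affinity matrix
      (∀ M : ℝ, 0 < M →
        ∀ (n d : ℕ) (X : Matrix (Fin d) (Fin n) ℝ) (Ω : Finset (Fin n × Fin n)),
          (∀ e ∈ Ω, e.1 < e.2) → Ω.Nonempty →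
        ∀ k r : ℕ, 1 ≤ k → k ≤ d → 1 ≤ r → r ≤ k →
        ∀ δ : ℝ, MatrixLogistic.BlockIsometry X Ω (2 * k) δ →
          (k : ℝ) ^ 2 * MatrixLogistic.rate Ω.card d k r ≤ M ^ 2 →
          ENNReal.ofReal
              (C₂ * ((1 - δ) / (1 + δ)) * MatrixLogistic.rate Ω.card d k r) ≤
            ⨅ Shat : (Ω → Bool) → Matrix (Fin n) (Fin n) ℝ,
              ⨆ Θ ∈ MatrixLogistic.paramSpace d k r M, MatrixLogistic.predRisk X Ω Shat Θ) := by
  refine ⟨32768, 1 / 20480, by norm_num, by norm_num, fun c hc0 => ⟨4 * c, by linarith, ?_⟩, ?_⟩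
  · intro M hM hc n d X Ω _ hΩ hX k r hk hkd hr _ Θhat hhat
    exact ⟨iSup₂_le fun Θ hΘ => MatrixLogistic.klRisk_le hM hc hΩ hX hk hkd hr hhat hΘ,
      iSup₂_le fun Θ hΘ => MatrixLogistic.predRisk_le hM hc hΩ hX hk hkd hr hhat hΘ⟩
  · intro M hM n d X Ω _ hΩ k r hk hkd hr hrk δ hiso hN
    exact MatrixLogistic.le_iInf_iSup_predRisk hM hΩ hk hkd hr hrk hiso hN
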